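/- Let $F$ be a brane tiling of genus $g\ge 1$: a finite tiling of a compact connected oriented surface of genus $g$ by polygonal tiles, at least two edges meeting at each vertex, whose $1$-skeleton is a bipartite graph with a chosen black/white colouring of its vertices. Let $Q$ be the dual quiver: its vertices are the tiles and its arrows are the edges, each arrow crossing its edge with the black end on the right, so that the arrows go clockwise around black vertices and anticlockwise around white ones. Let $W\in\mathbb{C}Q/[\mathbb{C}Q,\mathbb{C}Q]$ be the sum of the cycles of arrows around the black vertices minus the sum of the cycles around the white vertices, and let $A=A_F=\mathbb{C}Q/\langle \partial W/\partial X_E : E \text{ an arrow of } Q\rangle$ be the superpotential algebra, where $\partial/\partial X_E$ is the cyclic derivative. In $\mathbb{C}Q$ the product $uv$ is "first $u$, then $v$". Write $[u]\in A$ for the class of a path $u$; $u$ and $v$ are F-term equivalent if $[u]=[v]$. For an arrow $a$, let $\omega^{br}_{a,B}$ (respectively $\omega^{br}_{a,W}$) be the path from the head $h(a)$ to the tail $t(a)$ of $a$ that goes around the black (respectively white) end of $a$; the two have the same class $[\omega^{br}_a]$ in $A$. For a tile $i$, let $[\omega_i]$ be the common class of the simple loops at $i$, i.e. of the paths from $i$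 to $i$ making one revolution around a vertex of $i$. Let $e_i$ be the class of the path of length $0$ at $i$, let $A^+\subset A$ be the (non-unital) subalgebra generated by the paths of length at least $1$, and let $S_i=e_iA/e_iA^+$. Assume that $F$ is consistent: whenever two paths $u$ and $v$ end at the same tile $j$ and $[u][\omega_j]^n=[v][\omega_j]^n$ for some $n\ge 0$, then $[u]=[v]$. Let $G_0$ be the category whose objects are the tiles and whose morphisms are the paths of $Q$ up to F-term equivalence, and let $G_1$ be the groupoid obtained from $G_0$ by formally inverting all morphisms. For a morphism $\phi$ of $G_1$ let $A_\phi$ be the span of the classes of the paths with image $\phi$ in $G_1$. A grading of an algebra by a category is a decomposition into a direct sum of subspaces indexed by the morphisms, such that products of homogeneous elements of composable degrees have the composite degree, and products of homogeneous elements of non-composable degrees vanish; graded right modules are defined in the same way. Then $A=\bigoplus_\phi A_\phi$ is a grading of $A$ by $G_1$. Moreover, for each tile $i$ the right $A$-module $S_i$ is simple, and, with $E_1$ the set of arrows going into $i$ and $E_2$ the set of arrows going out of $i$, $$0\to[\omega_i]A\xrightarrow{\ \tau\ }\bigoplus_{a\in E_1}[\omega^{br}_a]A\xrightarrow{\ \sigma\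 }\bigoplus_{b\in E_2}[b]A\xrightarrow{\ \rho\ }e_iA$$ is a $G_1$-graded projective resolution of $S_i$. That is, the four modules are projective right $A$-modules; they and $S_i$ are $G_1$-graded by the gradings induced from that of $A$; the maps and the projection $e_iA\to S_i$ preserve degrees; and the sequence $0\to[\omega_i]A\to\bigoplus_{a\in E_1}[\omega^{br}_a]A\to\bigoplus_{b\in E_2}[b]A\to e_iA\to S_i\to0$ is exact. Here $\rho$ is the sum of the inclusions $[b]A\subseteq e_iA$; on the summand of $a\in E_1$, $\sigma$ is $\iota_1-\iota_2$, where $\iota_1$ and $\iota_2$ are the inclusions of $[\omega^{br}_a]A$ into the summands $[b_1]A$ and $[b_2]A$, with $b_1$ the first arrow of $\omega^{br}_{a,B}$ and $b_2$ the first arrow of $\omega^{br}_{a,W}$; and $\tau$ is the sum of the inclusions $[\omega_i]A\subseteq[\omega^{br}_a]A$ over $a\in E_1$. -/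

import Mathlib

open CategoryTheory

noncomputable section

universe u v

/-! ## Path algebras and cyclic derivatives -/

/-- The path algebra `ℂQ` of a quiver with vertex set `V`: the vector space with basis
the paths of `Q` (including the paths of length zero). -/
def PathAlgebra (V : Type u) [Quiver.{v} V] : Type _ :=
  (Σ i j : V, Quiver.Path i j) →₀ ℂ

namespace PathAlgebra

variable {V : Type u} [Quiver.{v} V]

instance : AddCommGroup (PathAlgebra V) :=
  inferInstanceAs (AddCommGroup ((Σ i j : V, Quiver.Path i j) →₀ ℂ))

instance : Module ℂ (PathAlgebra V) :=
  inferInstanceAs (Module ℂ ((Σ i j : V, Quiver.Path i j) →₀ ℂ))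

/-- The basis element of the path algebra given by a path. -/
def ofPath {i j : V} (p : Quiver.Path i j) : PathAlgebra V :=
  Finsupp.single (⟨i, j, p⟩ : Σ i j : V, Quiver.Path i j) (1 : ℂ)

/-- The linear map with prescribed values on paths. -/
def lift {M : Type*} [AddCommGroup M] [Module ℂ M]
    (f : ∀ i j : V, Quiver.Path i j → M) : PathAlgebra V →ₗ[ℂ] M :=
  Finsupp.linearCombination ℂ (fun p : Σ i j : V, Quiver.Path i j => f p.1 p.2.1 p.2.2)

@[simp] theorem lift_ofPath {M : Type*} [AddCommGroup M] [Module ℂ M]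
    (f : ∀ i j : V, Quiver.Path i j → M) {i j : V} (p : Quiver.Path i j) :
    lift f (ofPath p) = f i j p := by
  simp only [lift, ofPath]
  exact (Finsupp.linearCombination_single ℂ (1 : ℂ) _).trans (one_smul _ _)

theorem induction {P : PathAlgebra V → Prop} (x : PathAlgebra V)
    (zero : P 0) (add : ∀ x y, P x → P y → P (x + y))
    (smul : ∀ (c : ℂ) x, P x → P (c • x))
    (path : ∀ (i j : V) (p : Quiver.Path i j), P (ofPath p)) : P x := by
  refine Finsupp.induction_linear (motive := P) x zero (fun f g hf hg => add f g hf hg) ?_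
  rintro ⟨i, j, p⟩ c
  have h : (Finsupp.single (⟨i, j, p⟩ : Σ i j : V, Quiver.Path i j) c :
      (Σ i j : V, Quiver.Path i j) →₀ ℂ) = c • Finsupp.single ⟨i, j, p⟩ (1 : ℂ) := by
    simp
  rw [h]
  exact smul c _ (path i j p)

theorem ofPath_cast {i j i' j' : V} (hi : i = i') (hj : j = j') (p : Quiver.Path i j) :
    ofPath (p.cast hi hj) = ofPath p := by
  subst hi hj; rfl

open Classical in
/-- Multiplication in the path algebra: `p * q` is the concatenation "first `p`, then `q`"
if `q` starts where `p` ends, and zero otherwise. -/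
def mulLin : PathAlgebra V →ₗ[ℂ] PathAlgebra V →ₗ[ℂ] PathAlgebra V :=
  lift fun _ j p => lift fun k _ q =>
    if h : j = k then ofPath (p.comp (q.cast h.symm rfl)) else 0

instance : Mul (PathAlgebra V) := ⟨fun x y => mulLin x y⟩

theorem mul_def (x y : PathAlgebra V) : x * y = mulLin x y := rfl

theorem ofPath_mul {i j k : V} (p : Quiver.Path i j) (q : Quiver.Path j k) :
    ofPath p * ofPath q = ofPath (p.comp q) := by
  simp [mul_def, mulLin]

theorem ofPath_mul_of_ne {i j k l : V} (h : j ≠ k) (p : Quiver.Path i j)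
    (q : Quiver.Path k l) : ofPath p * ofPath q = 0 := by
  simp [mul_def, mulLin, h]

protected theorem mul_assoc' (x y z : PathAlgebra V) : x * y * z = x * (y * z) := by
  simp only [mul_def]
  induction x using induction with
  | zero => simp
  | add a b ha hb => simp [ha, hb]
  | smul c a ha => simp [ha]
  | path i j p =>
    induction y using induction with
    | zero => simp
    | add a b ha hb => simp [ha, hb]
    | smul c a ha => simp [ha]
    | path k l q =>
      induction z using induction with
      | zero => simp
      | add a b ha hb => simp [ha, hb]
      | smul c a ha => simp [ha]
      | path m n r =>
        simp only [← mul_def]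
        by_cases h : j = k
        · subst h
          by_cases h' : l = m
          · subst h'
            simp only [ofPath_mul, Quiver.Path.comp_assoc]
          · rw [ofPath_mul, ofPath_mul_of_ne h', ofPath_mul_of_ne h']
            simp [mul_def]
        · rw [ofPath_mul_of_ne h]
          by_cases h' : l = m
          · subst h'
            rw [ofPath_mul, ofPath_mul_of_ne h]
            simp [mul_def]
          · rw [ofPath_mul_of_ne h']
            simp [mul_def]

open Classical in
/-- The list of all factorisations `p = u · E · v` of a path `p`, one for each occurrence in `p`
of the arrow `E`, each recorded as the pair `(u, v)`. -/
def occurrences {a b : V} (E : a ⟶ b) {i : V} :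
    ∀ {j : V}, Quiver.Path i j → List (Quiver.Path i a × Quiver.Path b j)
  | _, .nil => []
  | _, .cons (b := c) (c := d) q e =>
    (occurrences E q).map (fun w => (w.1, w.2.cons e)) ++
      if h : ∃ (hc : c = a) (hd : d = b), Quiver.Hom.cast hc hd e = E then
        [(q.cast rfl h.choose, Quiver.Path.nil.cast h.choose_spec.choose rfl)]
      else []

open Classical in
/-- The cyclic derivative on `ℂQ`: a closed path is sent to the sum, over the occurrences of the
arrow `E` in it, of the path obtained by cyclically permuting that occurrence to the front and
deleting it; a path which is not closed is sent to zero. -/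
def cyclicDerivAux {a b : V} (E : a ⟶ b) : PathAlgebra V →ₗ[ℂ] PathAlgebra V :=
  lift fun i j p =>
    if h : i = j then
      ((occurrences E p).map fun w => ofPath (w.2.comp (w.1.cast h rfl))).sum
    else 0

theorem cyclicDerivAux_closed {a b : V} (E : a ⟶ b) {i : V} (p : Quiver.Path i i) :
    cyclicDerivAux E (ofPath p) =
      ((occurrences E p).map fun w => ofPath (w.2.comp w.1)).sum := by
  simp [cyclicDerivAux]

theorem cyclicDerivAux_not_closed {a b : V} (E : a ⟶ b) {i j : V} (h : i ≠ j)
    (p : Quiver.Path i j) : cyclicDerivAux E (ofPath p) = 0 := by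
  simp [cyclicDerivAux, h]

theorem occurrences_comp {a b : V} (E : a ⟶ b) {i j k : V} (p : Quiver.Path i j)
    (q : Quiver.Path j k) : (occurrences E (p.comp q)).Perm
      ((occurrences E p).map (fun w => (w.1, w.2.comp q)) ++
        (occurrences E q).map (fun w => (p.comp w.1, w.2))) := by
  classical
  induction q with
  | nil => simp [occurrences]
  | cons q e ih =>
    rename_i c d
    rw [Quiver.Path.comp_cons, occurrences, occurrences, List.map_append]
    rw [← List.append_assoc]
    refine List.Perm.append ?_ ?_
    · refine (ih.map _).trans ?_
      simp [Function.comp_def]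
    · by_cases h : ∃ (hc : c = a) (hd : d = b), Quiver.Hom.cast hc hd e = E
      · obtain ⟨rfl, rfl, rfl⟩ := h
        simp
      · simp [h]

theorem cyclicDerivAux_comp {a b : V} (E : a ⟶ b) {i j : V} (p : Quiver.Path i j)
    (q : Quiver.Path j i) : cyclicDerivAux E (ofPath (p.comp q)) =
      ((occurrences E p).map fun w => ofPath ((w.2.comp q).comp w.1)).sum +
        ((occurrences E q).map fun w => ofPath ((w.2.comp p).comp w.1)).sum := by
  rw [cyclicDerivAux_closed, ((occurrences_comp E p q).map _).sum_eq]
  simp [Function.comp_def]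

variable [Fintype V]

/-- The unit is the sum of the paths of length zero. -/
instance : One (PathAlgebra V) := ⟨∑ i : V, ofPath (Quiver.Path.nil : Quiver.Path i i)⟩

theorem one_def :
    (1 : PathAlgebra V) = ∑ i : V, ofPath (Quiver.Path.nil : Quiver.Path i i) := rfl

protected theorem one_mul' (x : PathAlgebra V) : 1 * x = x := by
  classical
  simp only [mul_def]
  induction x using induction with
  | zero => simp
  | add a b ha hb => simp [ha, hb]
  | smul c a ha => simp [ha]
  | path i j p =>
    rw [one_def, map_sum, LinearMap.sum_apply, Finset.sum_eq_single i]
    · rw [← mul_def, ofPath_mul, Quiver.Path.nil_comp]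
    · intro k _ hk
      rw [← mul_def, ofPath_mul_of_ne hk]
    · simp

protected theorem mul_one' (x : PathAlgebra V) : x * 1 = x := by
  classical
  simp only [mul_def]
  induction x using induction with
  | zero => simp
  | add a b ha hb => simp [ha, hb]
  | smul c a ha => simp [ha]
  | path i j p =>
    rw [one_def, map_sum, Finset.sum_eq_single j]
    · rw [← mul_def, ofPath_mul, Quiver.Path.comp_nil]
    · intro k _ hk
      rw [← mul_def, ofPath_mul_of_ne hk.symm]
    · simp

instance : Ring (PathAlgebra V) :=
  { (inferInstance : AddCommGroup (PathAlgebra V)) with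
    mul := (· * ·)
    one := 1
    left_distrib := fun x y z => by simp [mul_def]
    right_distrib := fun x y z => by simp [mul_def]
    zero_mul := fun x => by simp [mul_def]
    mul_zero := fun x => by simp [mul_def]
    mul_assoc := PathAlgebra.mul_assoc'
    one_mul := PathAlgebra.one_mul'
    mul_one := PathAlgebra.mul_one' }

instance : Algebra ℂ (PathAlgebra V) :=
  Algebra.ofModule (fun c x y => by simp [mul_def]) (fun c x y => by simp [mul_def])

variable (V) in
/-- The subspace `[ℂQ, ℂQ]` spanned by all commutators. -/
def commutators : Submodule ℂ (PathAlgebra V) :=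
  Submodule.span ℂ {z | ∃ x y : PathAlgebra V, z = x * y - y * x}

theorem cyclicDerivAux_mul_comm {a b : V} (E : a ⟶ b) (x y : PathAlgebra V) :
    cyclicDerivAux E (x * y) = cyclicDerivAux E (y * x) := by
  simp only [mul_def]
  induction x using induction with
  | zero => simp
  | add a b ha hb => simp [ha, hb]
  | smul c a ha => simp [ha]
  | path i j p =>
    induction y using induction with
    | zero => simp
    | add a b ha hb => simp [ha, hb]
    | smul c a ha => simp [ha]
    | path k l q =>
      simp only [← mul_def]
      by_cases h : j = k
      · subst h
        by_cases h' : l = i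
        · subst h'
          rw [ofPath_mul, ofPath_mul, cyclicDerivAux_comp, cyclicDerivAux_comp, add_comm]
        · rw [ofPath_mul, ofPath_mul_of_ne h', cyclicDerivAux_not_closed _ (Ne.symm h'), map_zero]
      · by_cases h' : l = i
        · subst h'
          rw [ofPath_mul, ofPath_mul_of_ne h, cyclicDerivAux_not_closed _ (Ne.symm h), map_zero]
        · rw [ofPath_mul_of_ne h, ofPath_mul_of_ne h']

/-- The cyclic derivative `∂/∂X_E : ℂQ/[ℂQ, ℂQ] → ℂQ` with respect to the arrow `E`. -/
def cyclicDeriv {a b : V} (E : a ⟶ b) :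
    (PathAlgebra V ⧸ commutators V) →ₗ[ℂ] PathAlgebra V :=
  (commutators V).liftQ (cyclicDerivAux E) <| by
    refine Submodule.span_le.2 ?_
    rintro z ⟨x, y, rfl⟩
    simp [cyclicDerivAux_mul_comm E x y]

@[simp] theorem cyclicDeriv_mkQ {a b : V} (E : a ⟶ b) (x : PathAlgebra V) :
    cyclicDeriv E ((commutators V).mkQ x) = cyclicDerivAux E x := rfl

theorem mkQ_mul_comm (x y : PathAlgebra V) :
    (commutators V).mkQ (x * y) = (commutators V).mkQ (y * x) := by
  rw [← sub_eq_zero, ← map_sub, ← LinearMap.mem_ker, Submodule.ker_mkQ]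
  exact Submodule.subset_span ⟨x, y, rfl⟩

end PathAlgebra
/-! ## Brane tilings -/

/-- The two colours of the vertices of a brane tiling. -/
inductive Colour
  | black
  | white

/-- A brane tiling, i.e. a tiling of a compact connected oriented surface whose `1`-skeleton is a
bipartite graph with a chosen black/white colouring, encoded as a combinatorial map.

`Edge` is the finite set of edges of the tiling. The permutation `next .black` sends an edge to the
edge following it in the *clockwise* order around its black end, and `next .white` sends an
edge to the edge following it in the *anticlockwise* order around its white end. Thus the black
(white) vertices are the cycles of `next .black` (of `next .white`), and the surface is recovered
by glueing a polygon along each cycle of the permutation `tilePerm` below.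

The surface is connected, and at least two edges meet at each vertex (which is certainly the case
for a tiling by convex polygons). -/
structure BraneTiling where
  /-- the edges of the tiling -/
  Edge : Type u
  [finite : Finite Edge]
  [nonempty : Nonempty Edge]
  /-- the next edge around the black, respectively white, end of an edge -/
  next : Colour → Equiv.Perm Edge
  connected : MulAction.IsPretransitive
    (Subgroup.closure ({next .black, next .white} : Set (Equiv.Perm Edge))) Edge
  next_ne : ∀ (c : Colour) (e : Edge), next c e ≠ e

namespace BraneTiling

attribute [instance] BraneTiling.finite BraneTiling.nonempty

/-- Each edge is also an arrow of the dual quiver, crossing the edge with the black end on its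
right. The arrows leaving a given tile are the edges of this tile, and `tilePerm` sends
such an arrow to the second next one in the cyclic order around the boundary of the tile (the edge
in between is an arrow which enters the tile). -/
def tilePerm (F : BraneTiling.{u}) : Equiv.Perm F.Edge :=
  F.next .white * (F.next .black)⁻¹

/-- The vertices of the tiling of a given colour. -/
def Vertex (F : BraneTiling.{u}) (c : Colour) : Type u :=
  Quotient (Equiv.Perm.SameCycle.setoid (F.next c))

/-- The end of colour `c` of an edge. -/
def vertex (F : BraneTiling.{u}) (c : Colour) (e : F.Edge) : F.Vertex c := Quotient.mk _ e

/-- A chosen edge ending at a given vertex. -/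
def Vertex.rep {F : BraneTiling.{u}} {c : Colour} (v : F.Vertex c) : F.Edge :=
  Quotient.out (s := Equiv.Perm.SameCycle.setoid (F.next c)) v

/-- The tiles. -/
def Tile (F : BraneTiling.{u}) : Type u :=
  Quotient (Equiv.Perm.SameCycle.setoid F.tilePerm)

instance (F : BraneTiling.{u}) : Finite F.Tile :=
  inferInstanceAs (Finite (Quotient _))

instance (F : BraneTiling.{u}) (c : Colour) : Finite (F.Vertex c) :=
  inferInstanceAs (Finite (Quotient _))

instance (F : BraneTiling.{u}) : Fintype F.Tile := Fintype.ofFinite _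

instance (F : BraneTiling.{u}) (c : Colour) : Fintype (F.Vertex c) := Fintype.ofFinite _

/-- The underlying surface has genus `g`: its Euler characteristic is `2 - 2g`. -/
def HasGenus (F : BraneTiling.{u}) (g : ℕ) : Prop :=
  (Nat.card (F.Vertex .black) + Nat.card (F.Vertex .white) : ℤ) - Nat.card F.Edge
    + Nat.card F.Tile = 2 - 2 * g

variable (F : BraneTiling.{u})

/-! ### The dual quiver -/

/-- The tile at which an arrow starts. -/
def tail (e : F.Edge) : F.Tile := Quotient.mk _ e

/-- The tile at which an arrow ends: the tile where the next arrow around the black end starts. -/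
def head (e : F.Edge) : F.Tile := F.tail (F.next .black e)

variable {F} in
theorem tail_next (c : Colour) (e : F.Edge) : F.tail (F.next c e) = F.head e := by
  cases c with
  | black => rfl
  | white =>
    refine (Quotient.sound ?_).symm
    exact ⟨1, by simp [tilePerm]⟩

/-- The dual quiver: its vertices are the tiles, its arrows are the edges of the tiling. -/
instance : Quiver F.Tile where
  Hom i j := {e : F.Edge // F.tail e = i ∧ F.head e = j}

/-- An edge of the tiling as an arrow of the dual quiver. -/
def arrow (e : F.Edge) : F.tail e ⟶ F.head e := ⟨e, rfl, rfl⟩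

/-- The path consisting of `k` consecutive arrows, beginning with `e`, that goes around the
end of colour `c` of the edge `e`. -/
def walk (c : Colour) (e : F.Edge) :
    ∀ k : ℕ, Quiver.Path (F.tail e) (F.tail ((F.next c)^[k] e))
  | 0 => Quiver.Path.nil
  | k + 1 => (walk c e k).cons
      ⟨(F.next c)^[k] e, rfl, by rw [Function.iterate_succ_apply', tail_next]⟩

/-- The number of edges meeting at the end of colour `c` of the edge `e`. -/
def valence (c : Colour) (e : F.Edge) : ℕ := Function.minimalPeriod (F.next c) e

variable {F} in
theorem iterate_valence (c : Colour) (e : F.Edge) : (F.next c)^[F.valence c e] e = e :=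
  Function.iterate_minimalPeriod

variable {F} in
theorem two_le_valence (c : Colour) (e : F.Edge) : 2 ≤ F.valence c e := by
  have h0 : 0 < F.valence c e := Function.minimalPeriod_pos_of_mem_periodicPts
    ((F.next c).injective.mem_periodicPts e)
  have h1 : F.valence c e ≠ 1 := fun h =>
    F.next_ne c e (Function.minimalPeriod_eq_one_iff_isFixedPt.1 h)
  omega

variable {F} in
theorem valence_next (c : Colour) (e : F.Edge) : F.valence c (F.next c e) = F.valence c e :=
  Function.minimalPeriod_apply ((F.next c).injective.mem_periodicPts e)

variable {F} in
theorem iterate_valence_sub_one (c : Colour) (e : F.Edge) :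
    (F.next c)^[F.valence c e - 1] (F.next c e) = e := by
  rw [← Function.iterate_succ_apply, Nat.succ_eq_add_one,
    Nat.sub_add_cancel (le_trans one_le_two (two_le_valence c e)), iterate_valence]

/-- The broken loop `ω^br_{a,c}` of an arrow `a`: the path from the head of `a` to its tail
going around the vertex of colour `c` of the edge `a`. -/
def brokenLoop (c : Colour) (a : F.Edge) : Quiver.Path (F.head a) (F.tail a) :=
  (F.walk c (F.next c a) (F.valence c a - 1)).cast (tail_next c a)
    (congrArg F.tail (iterate_valence_sub_one c a))

/-- The simple loop `a · ω^br_{a,c}`, a single revolution around the vertex of colour `c` of the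
edge `a`, starting with the arrow `a`. -/
def simpleLoop (c : Colour) (a : F.Edge) : Quiver.Path (F.tail a) (F.tail a) :=
  (F.arrow a).toPath.comp (F.brokenLoop c a)

/-! ### The superpotential algebra -/

/-- The superpotential `W ∈ ℂQ/[ℂQ, ℂQ]`: the sum, over the black vertices, of the cycle of arrows
going around the vertex, minus the same sum over the white vertices. -/
def superpotential : PathAlgebra F.Tile ⧸ PathAlgebra.commutators F.Tile :=
  ∑ v : F.Vertex .black, (PathAlgebra.commutators F.Tile).mkQ
      (PathAlgebra.ofPath (F.simpleLoop .black v.rep))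
    - ∑ v : F.Vertex .white, (PathAlgebra.commutators F.Tile).mkQ
      (PathAlgebra.ofPath (F.simpleLoop .white v.rep))

/-- The F-term relations: `(∂/∂X_E) W = 0` for each arrow `E` of the dual quiver. -/
def FTerm (x y : PathAlgebra F.Tile) : Prop :=
  (∃ e : F.Edge, x = PathAlgebra.cyclicDeriv (F.arrow e) F.superpotential) ∧ y = 0

/-- The superpotential algebra `A_F`, the quotient of `ℂQ` by the two-sided ideal generated
by the F-terms. -/
def Alg : Type u := RingQuot F.FTerm

instance : Ring F.Alg := inferInstanceAs (Ring (RingQuot F.FTerm))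

instance : Algebra ℂ F.Alg := inferInstanceAs (Algebra ℂ (RingQuot F.FTerm))

/-- The quotient map `ℂQ → A_F`. -/
def toAlg : PathAlgebra F.Tile →ₐ[ℂ] F.Alg := RingQuot.mkAlgHom ℂ F.FTerm

variable {F} in
/-- The class `[p] ∈ A_F` of a path `p`. -/
def pathClass {i j : F.Tile} (p : Quiver.Path i j) : F.Alg :=
  F.toAlg (PathAlgebra.ofPath p)

section lemmas

open PathAlgebra

variable {F}

theorem pathClass_comp {i j k : F.Tile} (p : Quiver.Path i j) (q : Quiver.Path j k) :
    pathClass (p.comp q) = pathClass p * pathClass q := by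
  rw [pathClass, ← ofPath_mul, map_mul]; rfl

theorem ofPath_cons {i j k : F.Tile} (p : Quiver.Path i j) (a : j ⟶ k) :
    ofPath (p.cons a) = ofPath p * ofPath (F.arrow a.1).toPath := by
  obtain ⟨e, rfl, rfl⟩ := a
  rw [ofPath_mul]; rfl

theorem walk_succ (c : Colour) (e : F.Edge) (k : ℕ) :
    ofPath (F.walk c e (k + 1)) =
      ofPath (F.walk c e k) * ofPath (F.arrow ((F.next c)^[k] e)).toPath :=
  ofPath_cons _ _

theorem ofPath_nil_mul {i j : F.Tile} (h : i = j) {k : F.Tile} (p : Quiver.Path j k) :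
    ofPath (Quiver.Path.nil : Quiver.Path i i) * ofPath p = ofPath p := by
  subst h
  rw [ofPath_mul, Quiver.Path.nil_comp]

theorem mul_ofPath_nil {i j : F.Tile} (h : i = j) {k : F.Tile} (p : Quiver.Path k i) :
    ofPath p * ofPath (Quiver.Path.nil : Quiver.Path j j) = ofPath p := by
  subst h
  rw [ofPath_mul, Quiver.Path.comp_nil]

theorem walk_succ' (c : Colour) (e : F.Edge) (k : ℕ) :
    ofPath (F.walk c e (k + 1)) =
      ofPath (F.arrow e).toPath * ofPath (F.walk c (F.next c e) k) := by
  induction k with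
  | zero =>
    rw [walk_succ]
    exact (ofPath_nil_mul rfl _).trans (mul_ofPath_nil (tail_next c e).symm _).symm
  | succ k ih =>
    rw [walk_succ, ih, walk_succ, mul_assoc]; rfl

theorem ofPath_brokenLoop (c : Colour) (a : F.Edge) : ofPath (F.brokenLoop c a) =
    ofPath (F.walk c (F.next c a) (F.valence c a - 1)) := ofPath_cast _ _ _

theorem ofPath_simpleLoop (c : Colour) (a : F.Edge) : ofPath (F.simpleLoop c a) =
    ofPath (F.arrow a).toPath * ofPath (F.brokenLoop c a) := (ofPath_mul _ _).symm

theorem brokenLoop_mul_arrow (c : Colour) (a : F.Edge) :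
    ofPath (F.brokenLoop c a) * ofPath (F.arrow a).toPath =
      ofPath (F.simpleLoop c (F.next c a)) := by
  have h : ∀ b : F.Edge, b = a → ofPath (F.arrow b).toPath = ofPath (F.arrow a).toPath := by
    rintro _ rfl; rfl
  rw [ofPath_simpleLoop, ofPath_brokenLoop, ofPath_brokenLoop, ← walk_succ', valence_next,
    walk_succ, h _ (iterate_valence_sub_one c a)]

theorem exists_brokenLoop_eq (c : Colour) (a : F.Edge) :
    ∃ x, ofPath (F.brokenLoop c a) = ofPath (F.arrow (F.next c a)).toPath * x := by
  obtain ⟨n, hn⟩ := Nat.exists_eq_add_of_le (two_le_valence c a)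
  refine ⟨ofPath (F.walk c (F.next c (F.next c a)) n), ?_⟩
  rw [ofPath_brokenLoop, hn, show 2 + n - 1 = n + 1 by omega, walk_succ']

theorem mkQ_simpleLoop_next (c : Colour) (a : F.Edge) :
    (commutators F.Tile).mkQ (ofPath (F.simpleLoop c (F.next c a))) =
      (commutators F.Tile).mkQ (ofPath (F.simpleLoop c a)) := by
  rw [← brokenLoop_mul_arrow, mkQ_mul_comm, ofPath_simpleLoop]

theorem mkQ_simpleLoop_congr (c : Colour) {a b : F.Edge} (h : (F.next c).SameCycle a b) :
    (commutators F.Tile).mkQ (ofPath (F.simpleLoop c a)) =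
      (commutators F.Tile).mkQ (ofPath (F.simpleLoop c b)) := by
  obtain ⟨n, hn⟩ := h.exists_nat_pow_eq
  subst hn
  clear h
  induction n with
  | zero => rfl
  | succ n ih => rw [pow_succ', Equiv.Perm.mul_apply, mkQ_simpleLoop_next, ih]

theorem occurrences_cast {a b i j i' j' : F.Tile} (E : a ⟶ b) (hi : i = i') (hj : j = j')
    (p : Quiver.Path i j) (h : occurrences E p = []) : occurrences E (p.cast hi hj) = [] := by
  subst hi hj; exact h

theorem val_cast {a b i j : F.Tile} (h : a = i) (h' : b = j) (e : a ⟶ b) :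
    (Quiver.Hom.cast h h' e).1 = e.1 := by
  subst h h'; rfl

theorem occurrences_walk (E e : F.Edge) (c : Colour) (k : ℕ)
    (h : ∀ m < k, (F.next c)^[m] e ≠ E) : occurrences (F.arrow E) (F.walk c e k) = [] := by
  induction k with
  | zero => rfl
  | succ k ih =>
    rw [walk, occurrences, ih (fun m hm => h m (by omega)), List.map_nil, List.nil_append,
      dif_neg]
    rintro ⟨h1, h2, h3⟩
    have := congrArg Subtype.val h3
    rw [val_cast] at this
    exact h k (by omega) this

theorem occurrences_brokenLoop (E e : F.Edge) (c : Colour)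
    (h : ∀ m, m + 1 < F.valence c e → (F.next c)^[m + 1] e ≠ E) :
    occurrences (F.arrow E) (F.brokenLoop c e) = [] :=
  occurrences_cast _ _ _ _ (occurrences_walk _ _ _ _ fun m hm => h m (by omega))

theorem cyclicDeriv_simpleLoop_self (c : Colour) (e : F.Edge) :
    cyclicDeriv (F.arrow e) ((commutators F.Tile).mkQ (ofPath (F.simpleLoop c e))) =
      ofPath (F.brokenLoop c e) := by
  have h : occurrences (F.arrow e) (F.brokenLoop c e) = [] :=
    occurrences_brokenLoop _ _ _ fun m hm h =>
      Function.not_isPeriodicPt_of_pos_of_lt_minimalPeriod (by omega) hm h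
  rw [cyclicDeriv_mkQ, simpleLoop, cyclicDerivAux_comp, h]
  simp [Quiver.Hom.toPath, occurrences]

theorem cyclicDeriv_simpleLoop_of_not (c : Colour) (e E : F.Edge)
    (hE : ¬ (F.next c).SameCycle e E) :
    cyclicDeriv (F.arrow E) ((commutators F.Tile).mkQ (ofPath (F.simpleLoop c e))) = 0 := by
  have h : occurrences (F.arrow E) (F.brokenLoop c e) = [] :=
    occurrences_brokenLoop _ _ _ fun m _ h => hE ⟨(m + 1 : ℕ), by
      rw [zpow_natCast, Equiv.Perm.coe_pow, h]⟩
  have h' : ¬ ∃ (hc : F.tail e = F.tail E) (hd : F.head e = F.head E),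
      Quiver.Hom.cast hc hd (F.arrow e) = F.arrow E := by
    rintro ⟨h1, h2, h3⟩
    have := congrArg Subtype.val h3
    rw [val_cast] at this
    exact hE ⟨0, this⟩
  rw [cyclicDeriv_mkQ, simpleLoop, cyclicDerivAux_comp, h]
  simp [Quiver.Hom.toPath, occurrences, h']

theorem cyclicDeriv_sum (c : Colour) (e : F.Edge) :
    cyclicDeriv (F.arrow e) (∑ v : F.Vertex c, (commutators F.Tile).mkQ
      (ofPath (F.simpleLoop c v.rep))) = ofPath (F.brokenLoop c e) := by
  classical
  rw [map_sum, Finset.sum_eq_single (F.vertex c e)]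
  · have h : (F.next c).SameCycle (F.vertex c e).rep e :=
      Quotient.mk_out (s := Equiv.Perm.SameCycle.setoid (F.next c)) e
    rw [mkQ_simpleLoop_congr c h, cyclicDeriv_simpleLoop_self]
  · intro v _ hv
    refine cyclicDeriv_simpleLoop_of_not _ _ _ fun h => hv ?_
    rw [← Quotient.out_eq v]
    exact Quotient.sound h
  · simp

/-- The F-term of the arrow `e` is the difference of its two broken loops. -/
theorem cyclicDeriv_superpotential (e : F.Edge) :
    cyclicDeriv (F.arrow e) F.superpotential =
      ofPath (F.brokenLoop .black e) - ofPath (F.brokenLoop .white e) := by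
  rw [superpotential, map_sub, cyclicDeriv_sum, cyclicDeriv_sum]

theorem pathClass_brokenLoop (c c' : Colour) (e : F.Edge) :
    pathClass (F.brokenLoop c e) = pathClass (F.brokenLoop c' e) := by
  have h : pathClass (F.brokenLoop .black e) = pathClass (F.brokenLoop .white e) := by
    rw [← sub_eq_zero, pathClass, pathClass, ← map_sub, ← cyclicDeriv_superpotential,
      ← map_zero F.toAlg]
    exact RingQuot.mkAlgHom_rel ℂ ⟨⟨e, rfl⟩, rfl⟩
  cases c <;> cases c' <;> first | rfl | exact h | exact h.symm

theorem pathClass_simpleLoop (c c' : Colour) (e : F.Edge) :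
    pathClass (F.simpleLoop c e) = pathClass (F.simpleLoop c' e) := by
  rw [simpleLoop, simpleLoop, pathClass_comp, pathClass_comp, pathClass_brokenLoop c c']

theorem pathClass_simpleLoop_next (c c' : Colour) (e : F.Edge) :
    pathClass (F.simpleLoop c (F.next c e)) =
      pathClass (F.brokenLoop c' e) * pathClass (F.arrow e).toPath := by
  rw [pathClass_brokenLoop c' c, pathClass, ← brokenLoop_mul_arrow, map_mul]; rfl

theorem pathClass_simpleLoop_of_tail_eq (c : Colour) {e e' : F.Edge} (h : F.tail e = F.tail e') :
    pathClass (F.simpleLoop c e) = pathClass (F.simpleLoop c e') := by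
  have key : ∀ e : F.Edge, pathClass (F.simpleLoop .black (F.tilePerm e)) =
      pathClass (F.simpleLoop .black e) := by
    intro e
    obtain ⟨a, rfl⟩ := (F.next .black).surjective e
    have : F.tilePerm (F.next .black a) = F.next .white a := by simp [tilePerm]
    rw [this, pathClass_simpleLoop .black .white, pathClass_simpleLoop_next .white .black,
      pathClass_simpleLoop_next .black .black]
  have h' : F.tilePerm.SameCycle e e' := Quotient.exact h
  obtain ⟨n, hn⟩ := h'.exists_nat_pow_eq
  subst hn
  rw [pathClass_simpleLoop c .black e, pathClass_simpleLoop c .black]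
  clear h h'
  induction n with
  | zero => rfl
  | succ n ih => rw [ih, pow_succ', Equiv.Perm.mul_apply, key]

end lemmas

/-- A chosen edge of a tile, crossed by an arrow that starts at this tile. -/
def Tile.rep {F : BraneTiling.{u}} (i : F.Tile) : F.Edge :=
  Quotient.out (s := Equiv.Perm.SameCycle.setoid F.tilePerm) i

variable {F} in
theorem tail_rep (i : F.Tile) : F.tail i.rep = i :=
  Quotient.out_eq (s := Equiv.Perm.SameCycle.setoid F.tilePerm) i

variable {F} in
/-- The class `[ω_i] ∈ A_F` of the simple loops at the tile `i` (all of them have the same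
class, see `loopClass_tail`). -/
def loopClass (i : F.Tile) : F.Alg := pathClass (F.simpleLoop .black i.rep)

variable {F} in
theorem loopClass_tail (c : Colour) (e : F.Edge) :
    loopClass (F.tail e) = pathClass (F.simpleLoop c e) := by
  rw [loopClass, pathClass_simpleLoop c .black]
  exact pathClass_simpleLoop_of_tail_eq .black (tail_rep (F.tail e))

/-- Consistency: if two paths `p` and `q` ending at the same tile `j` are weakly equivalent, that
is, `[p][ω_j]^n = [q][ω_j]^n` for some `n ≥ 0`, then they are F-term equivalent. -/
def IsConsistent : Prop :=
  ∀ ⦃i i' j : F.Tile⦄ (p : Quiver.Path i j) (q : Quiver.Path i' j),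
    (∃ n : ℕ, pathClass p * loopClass j ^ n = pathClass q * loopClass j ^ n) →
      pathClass p = pathClass q

end BraneTiling

/-! ## Gradings by categories -/

/-- The type of all morphisms of a category. -/
abbrev Mor (C : Type u) [Category.{v} C] : Type (max u v) := Σ x y : C, (x ⟶ y)

open Classical in
/-- A decomposition of (the underlying vector space of) an algebra `A` as a direct sum of subspaces
`V φ`, indexed by the morphisms of the category `C`, is a grading of `A` by `C` if the product is
compatible with composition, and vanishes on pieces of non-composable degrees. -/
structure IsAlgebraGrading {C : Type*} [Category C] {A : Type*} [Ring A] [Algebra ℂ A]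
    (V : Mor C → Submodule ℂ A) : Prop where
  isInternal : DirectSum.IsInternal V
  mul_mem : ∀ {x y z : C} (φ : x ⟶ y) (ψ : y ⟶ z) {a b : A},
    a ∈ V ⟨x, y, φ⟩ → b ∈ V ⟨y, z, ψ⟩ → a * b ∈ V ⟨x, z, φ ≫ ψ⟩
  mul_eq_zero : ∀ {x y z w : C} (φ : x ⟶ y) (ψ : z ⟶ w) {a b : A}, y ≠ z →
    a ∈ V ⟨x, y, φ⟩ → b ∈ V ⟨z, w, ψ⟩ → a * b = 0

open Classical in
/-- A grading of a right module `M` over the `C`-graded algebra `(A, V)`. Right `A`-modules are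
modules over the opposite algebra. -/
structure IsRightModuleGrading {C : Type*} [Category C] {A : Type*} [Ring A] [Algebra ℂ A]
    (V : Mor C → Submodule ℂ A) {M : Type*} [AddCommGroup M] [Module ℂ M] [Module Aᵐᵒᵖ M]
    (U : Mor C → Submodule ℂ M) : Prop where
  isInternal : DirectSum.IsInternal U
  smul_mem : ∀ {x y z : C} (φ : x ⟶ y) (ψ : y ⟶ z) {m : M} {a : A},
    m ∈ U ⟨x, y, φ⟩ → a ∈ V ⟨y, z, ψ⟩ → MulOpposite.op a • m ∈ U ⟨x, z, φ ≫ ψ⟩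
  smul_eq_zero : ∀ {x y z w : C} (φ : x ⟶ y) (ψ : z ⟶ w) {m : M} {a : A}, y ≠ z →
    m ∈ U ⟨x, y, φ⟩ → a ∈ V ⟨z, w, ψ⟩ → MulOpposite.op a • m = 0

/-- The sequence `0 → M₃ → M₂ → M₁ → M₀ → S → 0` of right modules over the `C`-graded algebra
`(A, V)`, with maps `d₃, d₂, d₁, ε` and with gradings `U₃, U₂, U₁, U₀, U` on the modules, is a
`C`-graded projective resolution of `S`: the modules are graded, the maps preserve degrees, the
modules `M₃, M₂, M₁, M₀` are projective, and the sequence is exact. -/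
structure IsGradedProjectiveResolution {C : Type*} [Category C] {A : Type*} [Ring A] [Algebra ℂ A]
    (V : Mor C → Submodule ℂ A) {M₃ M₂ M₁ M₀ S : Type*}
    [AddCommGroup M₃] [Module ℂ M₃] [Module Aᵐᵒᵖ M₃] [AddCommGroup M₂] [Module ℂ M₂] [Module Aᵐᵒᵖ M₂]
    [AddCommGroup M₁] [Module ℂ M₁] [Module Aᵐᵒᵖ M₁] [AddCommGroup M₀] [Module ℂ M₀] [Module Aᵐᵒᵖ M₀]
    [AddCommGroup S] [Module ℂ S] [Module Aᵐᵒᵖ S]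
    (U₃ : Mor C → Submodule ℂ M₃) (U₂ : Mor C → Submodule ℂ M₂) (U₁ : Mor C → Submodule ℂ M₁)
    (U₀ : Mor C → Submodule ℂ M₀) (U : Mor C → Submodule ℂ S)
    (d₃ : M₃ →ₗ[Aᵐᵒᵖ] M₂) (d₂ : M₂ →ₗ[Aᵐᵒᵖ] M₁) (d₁ : M₁ →ₗ[Aᵐᵒᵖ] M₀) (ε : M₀ →ₗ[Aᵐᵒᵖ] S) :
    Prop where
  grading₃ : IsRightModuleGrading V U₃
  grading₂ : IsRightModuleGrading V U₂
  grading₁ : IsRightModuleGrading V U₁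
  grading₀ : IsRightModuleGrading V U₀
  grading : IsRightModuleGrading V U
  map_mem₃ : ∀ (φ : Mor C), ∀ x ∈ U₃ φ, d₃ x ∈ U₂ φ
  map_mem₂ : ∀ (φ : Mor C), ∀ x ∈ U₂ φ, d₂ x ∈ U₁ φ
  map_mem₁ : ∀ (φ : Mor C), ∀ x ∈ U₁ φ, d₁ x ∈ U₀ φ
  map_mem : ∀ (φ : Mor C), ∀ x ∈ U₀ φ, ε x ∈ U φ
  projective₃ : Module.Projective Aᵐᵒᵖ M₃
  projective₂ : Module.Projective Aᵐᵒᵖ M₂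
  projective₁ : Module.Projective Aᵐᵒᵖ M₁
  projective₀ : Module.Projective Aᵐᵒᵖ M₀
  injective : Function.Injective d₃
  exact₂ : Function.Exact d₃ d₂
  exact₁ : Function.Exact d₂ d₁
  exact₀ : Function.Exact d₁ ε
  surjective : Function.Surjective ε

namespace BraneTiling

variable (F : BraneTiling.{u})

/-! ### The grading of the superpotential algebra -/

/-- F-term equivalence of paths: equality in the superpotential algebra. -/
def fTermRel : HomRel (Paths F.Tile) :=
  fun i j p q => pathClass (F := F) (i := i) (j := j) p = pathClass (F := F) (i := i) (j := j) q

/-- The category `G₀`: its objects are the tiles, its morphisms are the paths of the dual quiver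
up to F-term equivalence. -/
abbrev G₀ : Type u := CategoryTheory.Quotient F.fTermRel

/-- The category (groupoid) `G₁` obtained from `G₀` by formally inverting all morphisms. -/
abbrev G₁ : Type u := FreeGroupoid F.G₀

variable {F} in
/-- The degree of a path: the image in `G₁` of the morphism of `G₀` that it represents. -/
def degree {i j : F.Tile} (p : Quiver.Path i j) : Mor F.G₁ :=
  ⟨_, _, (FreeGroupoid.of F.G₀).map ((CategoryTheory.Quotient.functor F.fTermRel).map
    (X := (i : Paths F.Tile)) (Y := (j : Paths F.Tile)) p)⟩

/-- The homogeneous piece of degree `φ` of `A_F`, spanned by the classes of the paths of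
degree `φ`. -/
def piece (φ : Mor F.G₁) : Submodule ℂ F.Alg :=
  Submodule.span ℂ {x | ∃ (i j : F.Tile) (p : Quiver.Path i j), degree p = φ ∧ x = pathClass p}

variable {F}

/-- The right ideal `xA` of `A = A_F` generated by `x`. -/
abbrev rightIdeal (x : F.Alg) : Submodule F.Algᵐᵒᵖ F.Alg := Submodule.span F.Algᵐᵒᵖ {x}

/-- The homogeneous pieces of a right ideal. -/
def idealPiece (N : Submodule F.Algᵐᵒᵖ F.Alg) (φ : Mor F.G₁) : Submodule ℂ N :=
  (F.piece φ).comap (N.subtype.restrictScalars ℂ)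

/-- The homogeneous pieces of a (finite) direct sum of right ideals. -/
def sumPiece {ι : Type*} (N : ι → Submodule F.Algᵐᵒᵖ F.Alg) (φ : Mor F.G₁) :
    Submodule ℂ (∀ k, N k) :=
  Submodule.pi Set.univ fun k => idealPiece (N k) φ

/-! ### The complex attached to a tile -/

/-- The set `E₁` of the arrows going into the tile `i`. -/
abbrev Incoming (i : F.Tile) : Type u := {a : F.Edge // F.head a = i}

/-- The set `E₂` of the arrows going out of the tile `i`. -/
abbrev Outgoing (i : F.Tile) : Type u := {b : F.Edge // F.tail b = i}

instance (i : F.Tile) : Fintype (Incoming i) := Fintype.ofFinite _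

instance (i : F.Tile) : Fintype (Outgoing i) := Fintype.ofFinite _

theorem rightIdeal_le {x y : F.Alg} (h : ∃ z, x = y * z) : rightIdeal x ≤ rightIdeal y := by
  obtain ⟨z, rfl⟩ := h
  rw [rightIdeal, Submodule.span_singleton_le_iff_mem]
  exact Submodule.smul_mem _ (MulOpposite.op z) (Submodule.mem_span_singleton_self y)

/-- The class `[ω^br_a] ∈ A_F` of the two broken loops of the arrow `a`, which are F-term
equivalent. -/
abbrev brokenClass (a : F.Edge) : F.Alg := pathClass (F.brokenLoop .black a)

/-- The class `[b] ∈ A_F` of an arrow `b`. -/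
abbrev arrowClass (b : F.Edge) : F.Alg := pathClass (F.arrow b).toPath

/-- The idempotent `e_i ∈ A_F`. -/
abbrev idem (i : F.Tile) : F.Alg := pathClass (Quiver.Path.nil : Quiver.Path i i)

/-- `[ω_i]A ⊆ [ω^br_a]A` for an arrow `a` going into `i`. -/
theorem loopIdeal_le {i : F.Tile} (a : Incoming i) :
    rightIdeal (loopClass i) ≤ rightIdeal (brokenClass a.1) := by
  obtain ⟨a, rfl⟩ := a
  exact rightIdeal_le ⟨arrowClass a, (loopClass_tail .black (F.next .black a)).trans
    (pathClass_simpleLoop_next .black .black a)⟩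

/-- `[ω^br_a]A ⊆ [b]A` if `b` is the first arrow of the broken loop of `a` of colour `c`. -/
theorem brokenIdeal_le (c : Colour) (a : F.Edge) :
    rightIdeal (brokenClass a) ≤ rightIdeal (arrowClass (F.next c a)) := by
  obtain ⟨x, hx⟩ := exists_brokenLoop_eq c a
  exact rightIdeal_le ⟨F.toAlg x, by
    rw [brokenClass, pathClass_brokenLoop .black c, pathClass, hx, map_mul]; rfl⟩

/-- `[b]A ⊆ e_iA` for an arrow `b` going out of `i`. -/
theorem arrowIdeal_le {i : F.Tile} (b : Outgoing i) :
    rightIdeal (arrowClass b.1) ≤ rightIdeal (idem i) := by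
  obtain ⟨b, rfl⟩ := b
  exact rightIdeal_le ⟨arrowClass b, by rw [← pathClass_comp, Quiver.Path.nil_comp]⟩

/-- The arrow going out of `i` which is the first arrow of the broken loop of colour `c` of an
arrow `a` going into `i`. -/
def firstArrow {i : F.Tile} (c : Colour) (a : Incoming i) : Outgoing i :=
  ⟨F.next c a.1, (tail_next c a.1).trans a.2⟩

/-- The module `[ω_i]A`. -/
abbrev Term₃ (i : F.Tile) : Type u := rightIdeal (loopClass i)

/-- The module `⨁_{a ∈ E₁} [ω^br_a]A`; the direct sum is finite, so it is the product. -/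
abbrev Term₂ (i : F.Tile) : Type u := ∀ a : Incoming i, rightIdeal (brokenClass a.1)

/-- The module `⨁_{b ∈ E₂} [b]A`; the direct sum is finite, so it is the product. -/
abbrev Term₁ (i : F.Tile) : Type u := ∀ b : Outgoing i, rightIdeal (arrowClass b.1)

/-- The module `e_iA`. -/
abbrev Term₀ (i : F.Tile) : Type u := rightIdeal (idem i)

/-- The map `τ : [ω_i]A → ⨁_{a ∈ E₁} [ω^br_a]A`, the sum of the inclusions. -/
def tau (i : F.Tile) : Term₃ i →ₗ[F.Algᵐᵒᵖ] Term₂ i :=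
  LinearMap.pi fun a => Submodule.inclusion (loopIdeal_le a)

open Classical in
/-- The inclusion of `[ω^br_a]A` into the summand `[b]A`, where `b` is the first arrow of the
broken loop of colour `c` of `a`. -/
def iota {i : F.Tile} (c : Colour) (a : Incoming i) :
    rightIdeal (brokenClass a.1) →ₗ[F.Algᵐᵒᵖ] Term₁ i :=
  LinearMap.single F.Algᵐᵒᵖ (fun b : Outgoing i => rightIdeal (arrowClass b.1)) (firstArrow c a) ∘ₗ
    Submodule.inclusion (brokenIdeal_le c a.1)

/-- The map `σ : ⨁_{a ∈ E₁} [ω^br_a]A → ⨁_{b ∈ E₂} [b]A`, given on the summand of `a` by the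
inclusion for the black vertex of `a` minus the inclusion for the white vertex of `a`. -/
def sigma (i : F.Tile) : Term₂ i →ₗ[F.Algᵐᵒᵖ] Term₁ i :=
  ∑ a : Incoming i, (iota .black a - iota .white a) ∘ₗ
    LinearMap.proj (φ := fun a : Incoming i => rightIdeal (brokenClass a.1)) a

/-- The map `ρ : ⨁_{b ∈ E₂} [b]A → e_iA`, the sum of the inclusions. -/
def rho (i : F.Tile) : Term₁ i →ₗ[F.Algᵐᵒᵖ] Term₀ i :=
  ∑ b : Outgoing i, Submodule.inclusion (arrowIdeal_le b) ∘ₗ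
    LinearMap.proj (φ := fun b : Outgoing i => rightIdeal (arrowClass b.1)) b

variable (F) in
/-- The (non-unital) subalgebra `A⁺` of `A_F` generated by the paths of length at least one. -/
def algPlus : NonUnitalSubalgebra ℂ F.Alg :=
  NonUnitalAlgebra.adjoin ℂ
    {x | ∃ (i j : F.Tile) (p : Quiver.Path i j), 1 ≤ p.length ∧ x = pathClass p}

/-- The submodule `e_iA⁺` of `e_iA`. -/
def idemPlus (i : F.Tile) : Submodule F.Algᵐᵒᵖ (Term₀ i) :=
  (Submodule.span F.Algᵐᵒᵖ {x : F.Alg | ∃ y ∈ F.algPlus, x = idem i * y}).comap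
    (rightIdeal (idem i)).subtype

/-- The right module `S_i = e_iA / e_iA⁺`. -/
abbrev SimpleModule (i : F.Tile) : Type u := Term₀ i ⧸ idemPlus i

/-- The quotient grading on `S_i`. -/
def simplePiece (i : F.Tile) (φ : Mor F.G₁) : Submodule ℂ (SimpleModule i) :=
  (idealPiece (rightIdeal (idem i)) φ).map ((idemPlus i).mkQ.restrictScalars ℂ)

end BraneTiling

end

/-!
Write `[p]` for the class of a path `p` in `A = A_F`. Since the defining relations of `A` are
differences of paths, `A` has a basis consisting of the classes of paths up to elementary moves,
which replace the black broken loop of an arrow by the white one (`classBasis`). The right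
ideal `[p]A` is spanned by the basis elements represented by paths that begin with `p`
(`exists_of_mem_support`). Every statement can therefore be checked on basis elements: a degree is
attached to each of them, so that `A` and the right ideals are graded, and the coefficient of `e_i`
is an algebra homomorphism whose kernel cuts out `e_iA⁺`, so that `S_i` is one-dimensional. By
consistency, the classes of paths satisfy left cancellation, as every path can be completed on the
left to a power of a simple loop; hence `[p]A` is isomorphic to `e_jA` for a path `p` ending at `j`
and is projective.

Exactness at `⨁ [b]A` only expresses that `A` is defined by its relations: two equivalent
paths are connected by elementary moves, and a move affects the first arrow of the path only if it
takes place at the start, in which case the difference is in the image of `σ`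
(`placed_sub_placed_mem`, `exact_sigma`). At `⨁ [ω^br_a]A`, an element of the kernel of `σ` has all
its components equal, as the edges of a tile form one cycle, so that exactness amounts to
`⋂ [ω^br_a]A = [ω_i]A` (`mem_loopIdeal_of_forall_mem`). This is the topological heart of the proof,
and the only place where the genus matters.

In positive genus, counting dimensions gives a rational cocycle on the surface which is not a
coboundary (`exists_nontrivialCocycle`). It becomes the coboundary of a height function on the
universal covering, whose tiles are encoded as paths from `i` up to F-term equivalence and simple
loops. Consequently the covering is infinite: a finitely supported function on its edges that is
constant around all vertices vanishes (`eq_zero_of_mem_invariants`). By duality there is a flow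
along the edges of the covering whose only source is a vertex of the base tile (`exists_flow`).
The flow through the lift of a path plays the role of the winding angle around the base tile. If
`[p]` is not in `[ω_i]A`, then consistency shows that no path equivalent to `p` returns to the base
tile, and the flow changes only under moves at the start. If moreover `p` is equivalent to a path
beginning with the broken loop of `a` for each arrow `a` into `i`, then the first arrow can be
rotated once around the tile, which brings back the same flow, but changes it by a nonzero multiple
of the source: a contradiction.
-/

noncomputable section

namespace BraneTiling

open PathAlgebra

variable {F : BraneTiling.{u}}

/-! ### Path classes as a basis of the superpotential algebra -/

/-- An elementary F-term move: inside a path, the black broken loop of an arrow is replaced by the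
white one. -/
inductive FMove : ∀ {i j : F.Tile}, Quiver.Path i j → Quiver.Path i j → Prop
  | mk {i j : F.Tile} (a : F.Edge) (p : Quiver.Path i (F.head a)) (q : Quiver.Path (F.tail a) j) :
      FMove ((p.comp (F.brokenLoop .black a)).comp q) ((p.comp (F.brokenLoop .white a)).comp q)

variable (F) in
/-- Paths modulo the equivalence relation generated by the elementary moves. -/
abbrev PathClasses : Type u :=
  Σ i j : F.Tile, Quot (FMove (F := F) (i := i) (j := j))

/-- The class of a path modulo elementary moves. -/
def toClass {i j : F.Tile} (p : Quiver.Path i j) : F.PathClasses := ⟨i, j, Quot.mk _ p⟩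

theorem toClass_move {i j : F.Tile} {p q : Quiver.Path i j} (h : FMove p q) :
    toClass p = toClass q := by
  rw [toClass, Quot.sound h]; rfl

theorem toClass_surjective (c : F.PathClasses) : ∃ (i j : F.Tile) (p : Quiver.Path i j),
    toClass p = c := by
  obtain ⟨i, j, p⟩ := c
  induction p using Quot.ind with
  | mk p => exact ⟨i, j, p, rfl⟩

theorem toClass_eq_iff {i j : F.Tile} {p q : Quiver.Path i j} :
    toClass p = toClass q ↔ Relation.EqvGen FMove p q := by
  simp only [toClass, Sigma.mk.injEq, heq_eq_eq, true_and]
  exact Quot.eq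

theorem pathClass_move {i j : F.Tile} {p q : Quiver.Path i j} (h : FMove p q) :
    pathClass p = pathClass q := by
  cases h with
  | mk a p q => simp only [pathClass_comp, pathClass_brokenLoop .black .white]

variable (F) in
/-- The linear map from the path algebra to the vector space on the set of path classes. -/
def classMap : PathAlgebra F.Tile →ₗ[ℂ] (F.PathClasses →₀ ℂ) :=
  PathAlgebra.lift fun _ _ p => Finsupp.single (toClass p) 1

theorem classMap_ofPath {i j : F.Tile} (p : Quiver.Path i j) :
    F.classMap (ofPath p) = Finsupp.single (toClass p) 1 := by
  simp [classMap]

theorem classMap_mul_brokenLoop_mul (a : F.Edge) (x y : PathAlgebra F.Tile) :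
    F.classMap (x * ofPath (F.brokenLoop .black a) * y) =
      F.classMap (x * ofPath (F.brokenLoop .white a) * y) := by
  induction x using PathAlgebra.induction with
  | zero => simp
  | add x x' hx hx' => simp only [add_mul, map_add, hx, hx']
  | smul c x hx => simp only [smul_mul_assoc, map_smul, hx]
  | path i j p =>
    induction y using PathAlgebra.induction with
    | zero => simp
    | add x x' hx hx' => simp only [mul_add, map_add, hx, hx']
    | smul c x hx => simp only [mul_smul_comm, map_smul, hx]
    | path k l q =>
      by_cases hj : j = F.head a
      · subst hj
        by_cases hk : F.tail a = k
        · subst hk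
          simp only [ofPath_mul, classMap_ofPath, toClass_move (FMove.mk a p q)]
        · simp only [ofPath_mul, ofPath_mul_of_ne hk]
      · simp only [ofPath_mul_of_ne hj]

theorem classMap_eq_of_rel {x y : PathAlgebra F.Tile} (h : RingQuot.Rel F.FTerm x y)
    (u v : PathAlgebra F.Tile) : F.classMap (u * x * v) = F.classMap (u * y * v) := by
  induction h generalizing u v with
  | of h =>
    obtain ⟨⟨e, rfl⟩, rfl⟩ := h
    rw [cyclicDeriv_superpotential, mul_sub, sub_mul, map_sub, classMap_mul_brokenLoop_mul]
    simp
  | add_left _ ih => simp only [mul_add, add_mul, map_add, ih]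
  | mul_left _ ih => simpa only [mul_assoc] using ih u (_ * v)
  | mul_right _ ih => simpa only [mul_assoc] using ih (u * _) v

theorem classMap_eq_of_toAlg_eq {x y : PathAlgebra F.Tile} (h : F.toAlg x = F.toAlg y) :
    F.classMap x = F.classMap y := by
  have h1 : Relation.EqvGen (RingQuot.Rel F.FTerm) x y := by
    have h2 : (RingQuot.mkRingHom F.FTerm) x = (RingQuot.mkRingHom F.FTerm) y := by
      rw [← RingQuot.mkAlgHom_coe ℂ]; exact h
    simp only [RingQuot.mkRingHom_def] at h2
    exact Quot.eqvGen_exact (RingQuot.mk.inj h2)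
  clear h
  induction h1 with
  | rel x y h => simpa using classMap_eq_of_rel h 1 1
  | refl => rfl
  | symm _ _ _ ih => exact ih.symm
  | trans _ _ _ _ _ ih ih' => exact ih.trans ih'

theorem toAlg_surjective : Function.Surjective F.toAlg := RingQuot.mkAlgHom_surjective ℂ _

/-- The element of `A_F` given by a path class. -/
def classVal (c : F.PathClasses) : F.Alg :=
  Quot.lift (fun p => pathClass p) (fun _ _ h => pathClass_move h) c.2.2

@[simp] theorem classVal_toClass {i j : F.Tile} (p : Quiver.Path i j) :
    classVal (toClass p) = pathClass p := rfl

theorem linearCombination_classMap (x : PathAlgebra F.Tile) :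
    Finsupp.linearCombination ℂ classVal (F.classMap x) = F.toAlg x := by
  induction x using PathAlgebra.induction with
  | zero => simp
  | add x x' hx hx' => simp only [map_add, hx, hx']
  | smul c x hx => simp only [map_smul, hx]
  | path i j p => simp [classMap_ofPath, pathClass]

theorem classMap_surjective : Function.Surjective (classMap F) := by
  intro l
  induction l using Finsupp.induction_linear with
  | zero => exact ⟨0, map_zero _⟩
  | add f g hf hg =>
    obtain ⟨x, rfl⟩ := hf
    obtain ⟨y, rfl⟩ := hg
    exact ⟨x + y, map_add _ _ _⟩
  | single c z =>
    obtain ⟨i, j, p, rfl⟩ := toClass_surjective c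
    exact ⟨z • ofPath p, by simp [classMap_ofPath]⟩

variable (F) in
/-- The basis of `A_F` consisting of the classes of the paths. -/
def classBasis : Module.Basis F.PathClasses ℂ F.Alg :=
  Module.Basis.mk (v := classVal)
    (by
      refine linearIndependent_iff.2 fun l hl => ?_
      obtain ⟨x, rfl⟩ := classMap_surjective l
      rw [linearCombination_classMap, ← map_zero F.toAlg] at hl
      rw [classMap_eq_of_toAlg_eq hl, map_zero])
    (by
      rintro a -
      obtain ⟨x, rfl⟩ := toAlg_surjective a
      rw [← linearCombination_classMap, Finsupp.mem_span_range_iff_exists_finsupp]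
      exact ⟨_, rfl⟩)

theorem classBasis_apply (c : F.PathClasses) : F.classBasis c = classVal c := by
  simp [classBasis]

theorem classBasis_toClass {i j : F.Tile} (p : Quiver.Path i j) :
    F.classBasis (toClass p) = pathClass p := by
  simp [classBasis_apply]

theorem repr_pathClass {i j : F.Tile} (p : Quiver.Path i j) :
    (F.classBasis).repr (pathClass p) = Finsupp.single (toClass p) 1 := by
  rw [← classBasis_toClass, Module.Basis.repr_self]

/-- Linear induction on elements of `A_F`, starting from the classes of paths. -/
theorem alg_induction {P : F.Alg → Prop} (x : F.Alg) (zero : P 0)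
    (add : ∀ x y, P x → P y → P (x + y)) (smul : ∀ (c : ℂ) x, P x → P (c • x))
    (path : ∀ (i j : F.Tile) (p : Quiver.Path i j), P (pathClass p)) : P x := by
  obtain ⟨x, rfl⟩ := toAlg_surjective x
  induction x using PathAlgebra.induction with
  | zero => rwa [map_zero]
  | add x y hx hy => rw [map_add]; exact add _ _ hx hy
  | smul c x hx => rw [map_smul]; exact smul _ _ hx
  | path i j p => exact path i j p

theorem toClass_eq_of_pathClass_eq {i j k l : F.Tile} {p : Quiver.Path i j} {q : Quiver.Path k l}
    (h : pathClass p = pathClass q) : toClass p = toClass q := by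
  rw [← classBasis_toClass, ← classBasis_toClass] at h
  exact (F.classBasis).injective h

theorem pathClass_eq_iff {i j : F.Tile} {p q : Quiver.Path i j} :
    pathClass p = pathClass q ↔ Relation.EqvGen FMove p q :=
  ⟨fun h => toClass_eq_iff.1 (toClass_eq_of_pathClass_eq h), fun h => by
    rw [← classVal_toClass, toClass_eq_iff.2 h, classVal_toClass]⟩

theorem tail_eq_of_pathClass_eq {i j k l : F.Tile} {p : Quiver.Path i j} {q : Quiver.Path k l}
    (h : pathClass p = pathClass q) : i = k :=
  congrArg Sigma.fst (toClass_eq_of_pathClass_eq h)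

theorem head_eq_of_pathClass_eq {i j k l : F.Tile} {p : Quiver.Path i j} {q : Quiver.Path k l}
    (h : pathClass p = pathClass q) : j = l :=
  congrArg (fun c : F.PathClasses => c.2.1) (toClass_eq_of_pathClass_eq h)

theorem pathClass_mul_of_ne {i j k l : F.Tile} (h : j ≠ k) (p : Quiver.Path i j)
    (q : Quiver.Path k l) : pathClass p * pathClass q = 0 := by
  rw [pathClass, pathClass, ← map_mul, ofPath_mul_of_ne h, map_zero]

theorem pathClass_cast {i j i' j' : F.Tile} (hi : i = i') (hj : j = j') (p : Quiver.Path i j) :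
    pathClass (p.cast hi hj) = pathClass p := by
  subst hi hj; rfl

theorem length_cast {i j i' j' : F.Tile} (hi : i = i') (hj : j = j') (p : Quiver.Path i j) :
    (p.cast hi hj).length = p.length := by
  subst hi hj; rfl

/-! ### Paths of length zero -/

theorem length_walk (c : Colour) (e : F.Edge) (k : ℕ) : (F.walk c e k).length = k := by
  induction k with
  | zero => rfl
  | succ k ih => rw [walk, Quiver.Path.length_cons, ih]

theorem length_brokenLoop (c : Colour) (e : F.Edge) :
    (F.brokenLoop c e).length = F.valence c e - 1 := by
  rw [brokenLoop, length_cast, length_walk]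

theorem length_brokenLoop_pos (c : Colour) (e : F.Edge) : 0 < (F.brokenLoop c e).length := by
  rw [length_brokenLoop]
  have := F.two_le_valence c e
  omega

theorem length_eq_zero_iff_of_eqvGen {i j : F.Tile} {p q : Quiver.Path i j}
    (h : Relation.EqvGen FMove p q) : p.length = 0 ↔ q.length = 0 := by
  induction h with
  | rel p q h =>
    cases h with
    | mk a p q =>
      have := length_brokenLoop_pos .black a
      have := length_brokenLoop_pos .white a
      simp only [Quiver.Path.length_comp]
      omega
  | refl => rfl
  | symm _ _ _ ih => exact ih.symm
  | trans _ _ _ _ _ ih ih' => exact ih.trans ih'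

/-- A path of length zero is F-term equivalent only to itself, since every broken loop has positive
length. -/
theorem length_eq_zero_iff_of_pathClass_eq {i j k l : F.Tile} {p : Quiver.Path i j}
    {q : Quiver.Path k l} (h : pathClass p = pathClass q) : p.length = 0 ↔ q.length = 0 := by
  obtain rfl := tail_eq_of_pathClass_eq h
  obtain rfl := head_eq_of_pathClass_eq h
  exact length_eq_zero_iff_of_eqvGen (pathClass_eq_iff.1 h)

/-! ### Simple loops and cancellation -/

theorem arrowClass_cons {i j k : F.Tile} (p : Quiver.Path i j) (a : j ⟶ k) :
    pathClass (p.cons a) = pathClass p * arrowClass a.1 := by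
  obtain ⟨a, rfl, rfl⟩ := a
  exact pathClass_comp p (F.arrow a).toPath

theorem pathClass_toPath {i j : F.Tile} (a : i ⟶ j) : pathClass a.toPath = arrowClass a.1 := by
  obtain ⟨a, rfl, rfl⟩ := a
  rfl

theorem pathClass_nil_mul {i j : F.Tile} (p : Quiver.Path i j) :
    idem i * pathClass p = pathClass p := by
  rw [← pathClass_comp, Quiver.Path.nil_comp]

theorem pathClass_mul_nil {i j : F.Tile} (p : Quiver.Path i j) :
    pathClass p * idem j = pathClass p := by
  rw [← pathClass_comp, Quiver.Path.comp_nil]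

theorem arrow_mul_brokenClass (a : F.Edge) :
    arrowClass a * brokenClass a = loopClass (F.tail a) := by
  rw [loopClass_tail .black, simpleLoop, pathClass_comp]

theorem brokenClass_mul_arrow (a : F.Edge) :
    brokenClass a * arrowClass a = loopClass (F.head a) := by
  rw [head, loopClass_tail .black, pathClass_simpleLoop_next .black .black]

theorem loopClass_mul_arrowClass (a : F.Edge) :
    loopClass (F.tail a) * arrowClass a = arrowClass a * loopClass (F.head a) := by
  rw [← arrow_mul_brokenClass, ← brokenClass_mul_arrow, mul_assoc]

theorem loopClass_mul_idem (i : F.Tile) : loopClass i * idem i = loopClass i := by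
  rw [← tail_rep i, loopClass_tail .black, pathClass_mul_nil]

theorem idem_mul_loopClass (i : F.Tile) : idem i * loopClass i = loopClass i := by
  rw [← tail_rep i, loopClass_tail .black, pathClass_nil_mul]

/-- Simple loops can be moved along any path. -/
theorem loopClass_mul_pathClass {i j : F.Tile} (p : Quiver.Path i j) :
    loopClass i * pathClass p = pathClass p * loopClass j := by
  induction p with
  | nil => exact (loopClass_mul_idem i).trans (idem_mul_loopClass i).symm
  | cons p a ih =>
    rw [arrowClass_cons, ← mul_assoc, ih, mul_assoc, mul_assoc]
    obtain ⟨a, rfl, rfl⟩ := a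
    rw [loopClass_mul_arrowClass]

theorem loopClass_pow_mul_pathClass {i j : F.Tile} (p : Quiver.Path i j) (n : ℕ) :
    loopClass i ^ n * pathClass p = pathClass p * loopClass j ^ n := by
  induction n with
  | zero => simp
  | succ n ih =>
    rw [pow_succ, pow_succ, mul_assoc, loopClass_mul_pathClass, ← mul_assoc, ih, mul_assoc]

variable (F) in
/-- The path making `n` revolutions around the black end of the chosen edge of the tile `i`. -/
def loopPow (i : F.Tile) : ℕ → Quiver.Path i i
  | 0 => Quiver.Path.nil
  | n + 1 => (loopPow i n).comp ((F.simpleLoop .black i.rep).cast (tail_rep i) (tail_rep i))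

theorem pathClass_loopPow (i : F.Tile) (n : ℕ) :
    pathClass (F.loopPow i n) = idem i * loopClass i ^ n := by
  induction n with
  | zero => simp [loopPow]
  | succ n ih =>
    rw [loopPow, pathClass_comp, ih, pathClass_cast, mul_assoc, pow_succ]; rfl

theorem pathClass_comp_loopPow {i j : F.Tile} (p : Quiver.Path i j) (n : ℕ) :
    pathClass (p.comp (F.loopPow j n)) = pathClass p * loopClass j ^ n := by
  rw [pathClass_comp, pathClass_loopPow, ← mul_assoc, pathClass_mul_nil]

/-- Every path can be completed on the left to a power of a simple loop. -/
theorem exists_mul_pathClass {i j : F.Tile} (p : Quiver.Path i j) :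
    ∃ (q : Quiver.Path j i) (n : ℕ), pathClass q * pathClass p = idem j * loopClass j ^ n := by
  induction p with
  | nil => exact ⟨Quiver.Path.nil, 0, by rw [pow_zero, mul_one]; exact pathClass_nil_mul _⟩
  | cons p a ih =>
    obtain ⟨q, n, hq⟩ := ih
    obtain ⟨a, rfl, rfl⟩ := a
    refine ⟨(F.brokenLoop .black a).comp q, n + 1, ?_⟩
    rw [arrowClass_cons, pathClass_comp, mul_assoc, ← mul_assoc (pathClass q), hq,
      ← mul_assoc, ← mul_assoc, pathClass_mul_nil, ← loopClass_pow_mul_pathClass, mul_assoc,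
      brokenClass_mul_arrow, ← pow_succ]
    have := loopClass_pow_mul_pathClass
      (Quiver.Path.nil : Quiver.Path (F.head a) (F.head a)) (n + 1)
    rw [pow_succ, mul_assoc, loopClass_mul_idem, ← pow_succ] at this
    exact this

/-- Left cancellation in the superpotential algebra of a consistent tiling. -/
theorem IsConsistent.pathClass_left_cancel (hc : F.IsConsistent) {i j k l : F.Tile}
    (p : Quiver.Path i j) {q : Quiver.Path j k} {q' : Quiver.Path j l}
    (h : pathClass p * pathClass q = pathClass p * pathClass q') :
    pathClass q = pathClass q' := by
  obtain rfl : k = l := by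
    rw [← pathClass_comp, ← pathClass_comp] at h
    exact head_eq_of_pathClass_eq h
  obtain ⟨r, n, hr⟩ := exists_mul_pathClass p
  have h' := congrArg (pathClass r * ·) h
  simp only [← mul_assoc, hr] at h'
  rw [mul_assoc, mul_assoc, loopClass_pow_mul_pathClass, loopClass_pow_mul_pathClass, ← mul_assoc,
    ← mul_assoc, pathClass_nil_mul, pathClass_nil_mul] at h'
  exact hc q q' ⟨n, h'⟩

/-! ### Right ideals generated by path classes -/

theorem mem_rightIdeal {x y : F.Alg} : y ∈ rightIdeal x ↔ ∃ z, y = x * z := by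
  rw [rightIdeal, Submodule.mem_span_singleton]
  constructor
  · rintro ⟨z, rfl⟩
    exact ⟨z.unop, rfl⟩
  · rintro ⟨z, rfl⟩
    exact ⟨MulOpposite.op z, rfl⟩

theorem mul_mem_rightIdeal {x y : F.Alg} (h : y ∈ rightIdeal x) (z : F.Alg) :
    y * z ∈ rightIdeal x :=
  Submodule.smul_mem _ (MulOpposite.op z) h

/-- An element of the right ideal generated by a path class is a combination of classes of paths
beginning with that path. -/
theorem exists_of_mem_support {i j : F.Tile} {p : Quiver.Path i j} {y : F.Alg}
    (hy : y ∈ rightIdeal (pathClass p)) {c : F.PathClasses} (h : (F.classBasis).repr y c ≠ 0) :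
    ∃ (k : F.Tile) (q : Quiver.Path j k), classVal c = pathClass (p.comp q) := by
  classical
  obtain ⟨z, rfl⟩ := mem_rightIdeal.1 hy
  clear hy
  induction z using alg_induction with
  | zero => simp at h
  | add x y hx hy =>
    by_cases hx' : (F.classBasis).repr (pathClass p * x) c = 0
    · refine hy ?_
      rwa [mul_add, map_add, Finsupp.add_apply, hx', zero_add] at h
    · exact hx hx'
  | smul r x hx =>
    refine hx fun h' => h ?_
    rw [mul_smul_comm, map_smul, Finsupp.smul_apply, h', smul_zero]
  | path k l q =>
    by_cases hk : j = k
    · subst hk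
      rw [← pathClass_comp, repr_pathClass, Finsupp.single_apply] at h
      refine ⟨l, q, ?_⟩
      rw [← classVal_toClass, ← (ite_ne_right_iff.1 h).1]
    · rw [pathClass_mul_of_ne hk] at h
      simp at h

theorem classVal_mem_of_repr_ne_zero {i j : F.Tile} {p : Quiver.Path i j} {y : F.Alg}
    (hy : y ∈ rightIdeal (pathClass p)) {c : F.PathClasses} (h : (F.classBasis).repr y c ≠ 0) :
    classVal c ∈ rightIdeal (pathClass p) := by
  obtain ⟨k, q, hq⟩ := exists_of_mem_support hy h
  rw [hq, pathClass_comp]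
  exact mem_rightIdeal.2 ⟨_, rfl⟩

/-- A path class lies in the right ideal generated by `[p]` if and only if the path is F-term
equivalent to one beginning with `p`. -/
theorem exists_of_pathClass_mem {i j k l : F.Tile} {p : Quiver.Path i j} {r : Quiver.Path k l}
    (hr : pathClass r ∈ rightIdeal (pathClass p)) :
    ∃ q : Quiver.Path j l, pathClass r = pathClass (p.comp q) := by
  obtain ⟨m, q, hq⟩ := exists_of_mem_support hr (c := toClass r) (by simp [repr_pathClass])
  rw [classVal_toClass] at hq
  obtain rfl := head_eq_of_pathClass_eq hq
  exact ⟨q, hq⟩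

theorem mem_of_forall_repr_ne_zero {N : Submodule F.Algᵐᵒᵖ F.Alg} {y : F.Alg}
    (h : ∀ c, F.classBasis.repr y c ≠ 0 → classVal c ∈ N) : y ∈ N := by
  rw [← F.classBasis.linearCombination_repr y, Finsupp.linearCombination_apply]
  refine Submodule.sum_mem _ fun c hc => ?_
  simp only [classBasis_apply]
  exact N.smul_of_tower_mem _ (h c (Finsupp.mem_support_iff.1 hc))

/-! ### Gradings -/

/-- A family of subspaces is a direct sum decomposition as soon as it spans and there are component
maps; for flexibility these take values in a space containing the given one. -/
theorem isInternal_of_components {κ M M' : Type*} [DecidableEq κ] [AddCommGroup M] [Module ℂ M]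
    [AddCommGroup M'] [Module ℂ M'] (U : κ → Submodule ℂ M) (ι : M →ₗ[ℂ] M')
    (hι : Function.Injective ι) (P : κ → M →ₗ[ℂ] M') (hP : ∀ φ, ∀ x ∈ U φ, P φ x = ι x)
    (hP' : ∀ φ ψ, ψ ≠ φ → ∀ x ∈ U ψ, P φ x = 0) (hU : ∀ x, x ∈ ⨆ φ, U φ) :
    DirectSum.IsInternal U := by
  rw [DirectSum.isInternal_submodule_iff_iSupIndep_and_iSup_eq_top]
  refine ⟨fun φ => ?_, eq_top_iff.2 fun x _ => hU x⟩
  have h : ⨆ ψ, ⨆ (_ : ψ ≠ φ), U ψ ≤ LinearMap.ker (P φ) :=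
    iSup₂_le fun ψ hψ x hx => hP' φ ψ hψ x hx
  refine Submodule.disjoint_def.2 fun x hx hx' => hι ?_
  rw [← hP φ x hx, map_zero]
  exact h hx'

theorem degree_eq_of_pathClass_eq {i j : F.Tile} {p q : Quiver.Path i j}
    (h : pathClass p = pathClass q) : degree p = degree q := by
  have : (CategoryTheory.Quotient.functor F.fTermRel).map
      (X := (i : Paths F.Tile)) (Y := (j : Paths F.Tile)) p =
      (CategoryTheory.Quotient.functor F.fTermRel).map
      (X := (i : Paths F.Tile)) (Y := (j : Paths F.Tile)) q :=
    CategoryTheory.Quotient.sound _ h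
  rw [degree, this]; rfl

/-- The degree of a path class. -/
def classDegree (c : F.PathClasses) : Mor F.G₁ :=
  Quot.lift (fun p => degree p) (fun _ _ h => degree_eq_of_pathClass_eq (pathClass_move h)) c.2.2

@[simp] theorem classDegree_toClass {i j : F.Tile} (p : Quiver.Path i j) :
    classDegree (toClass p) = degree p := rfl

theorem pathClass_mem_piece {i j : F.Tile} (p : Quiver.Path i j) :
    pathClass p ∈ F.piece (degree p) :=
  Submodule.subset_span ⟨i, j, p, rfl, rfl⟩

theorem classVal_mem_piece (c : F.PathClasses) : classVal c ∈ F.piece (classDegree c) := by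
  obtain ⟨i, j, p, rfl⟩ := toClass_surjective c
  exact pathClass_mem_piece p

open Classical in
/-- The projection of `A_F` onto its homogeneous component of a given degree. -/
def component (φ : Mor F.G₁) : F.Alg →ₗ[ℂ] F.Alg :=
  F.classBasis.constr ℂ fun c => if classDegree c = φ then classVal c else 0

open Classical in
theorem component_pathClass (φ : Mor F.G₁) {i j : F.Tile} (p : Quiver.Path i j) :
    component φ (pathClass p) = if degree p = φ then pathClass p else 0 := by
  have h := F.classBasis.constr_basis ℂ
    (fun c => if classDegree c = φ then classVal c else 0) (toClass p)
  rw [classBasis_toClass] at h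
  exact h

theorem component_of_mem {φ : Mor F.G₁} {x : F.Alg} (hx : x ∈ F.piece φ) :
    component φ x = x := by
  induction hx using Submodule.span_induction with
  | mem x h =>
    obtain ⟨i, j, p, h, rfl⟩ := h
    rw [component_pathClass, if_pos h]
  | zero => exact map_zero _
  | add x y _ _ hx hy => rw [map_add, hx, hy]
  | smul c x _ hx => rw [map_smul, hx]

theorem component_of_mem_of_ne {φ ψ : Mor F.G₁} (h : ψ ≠ φ) {x : F.Alg} (hx : x ∈ F.piece ψ) :
    component φ x = 0 := by
  induction hx using Submodule.span_induction with
  | mem x h' =>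
    obtain ⟨i, j, p, rfl, rfl⟩ := h'
    rw [component_pathClass, if_neg h]
  | zero => exact map_zero _
  | add x y _ _ hx hy => rw [map_add, hx, hy, add_zero]
  | smul c x _ hx => rw [map_smul, hx, smul_zero]

theorem degree_comp {i j k : F.Tile} (p : Quiver.Path i j) (q : Quiver.Path j k) :
    degree (p.comp q) = ⟨_, _, (degree p).2.2 ≫ (degree q).2.2⟩ := by
  simp only [degree]
  congr 2
  rw [← Functor.map_comp]; rfl

theorem piece_mul_mem {x y z : F.G₁} (φ : x ⟶ y) (ψ : y ⟶ z) {a b : F.Alg}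
    (ha : a ∈ F.piece ⟨x, y, φ⟩) (hb : b ∈ F.piece ⟨y, z, ψ⟩) :
    a * b ∈ F.piece ⟨x, z, φ ≫ ψ⟩ := by
  induction ha using Submodule.span_induction with
  | zero => rw [zero_mul]; exact Submodule.zero_mem _
  | add x y _ _ hx hy => rw [add_mul]; exact Submodule.add_mem _ hx hy
  | smul c x _ hx => rw [smul_mul_assoc]; exact Submodule.smul_mem _ _ hx
  | mem a ha =>
    induction hb using Submodule.span_induction with
    | zero => rw [mul_zero]; exact Submodule.zero_mem _
    | add x y _ _ hx hy => rw [mul_add]; exact Submodule.add_mem _ hx hy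
    | smul c x _ hx => rw [mul_smul_comm]; exact Submodule.smul_mem _ _ hx
    | mem b hb =>
      obtain ⟨i, j, p, hp, rfl⟩ := ha
      obtain ⟨k, l, q, hq, rfl⟩ := hb
      by_cases h : j = k
      · subst h
        cases hp
        rw [degree] at hq
        simp only [Sigma.mk.injEq, heq_eq_eq, true_and] at hq
        obtain ⟨rfl, hq⟩ := hq
        cases hq
        rw [← pathClass_comp]
        refine Submodule.subset_span ⟨_, _, _, ?_, rfl⟩
        exact degree_comp p q
      · rw [pathClass_mul_of_ne h]
        exact Submodule.zero_mem _

theorem piece_mul_eq_zero {x y z w : F.G₁} (φ : x ⟶ y) (ψ : z ⟶ w) {a b : F.Alg} (hyz : y ≠ z)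
    (ha : a ∈ F.piece ⟨x, y, φ⟩) (hb : b ∈ F.piece ⟨z, w, ψ⟩) : a * b = 0 := by
  induction ha using Submodule.span_induction with
  | zero => rw [zero_mul]
  | add x y _ _ hx hy => rw [add_mul, hx, hy, add_zero]
  | smul c x _ hx => rw [smul_mul_assoc, hx, smul_zero]
  | mem a ha =>
    induction hb using Submodule.span_induction with
    | zero => rw [mul_zero]
    | add x y _ _ hx hy => rw [mul_add, hx, hy, add_zero]
    | smul c x _ hx => rw [mul_smul_comm, hx, smul_zero]
    | mem b hb =>
      obtain ⟨i, j, p, hp, rfl⟩ := ha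
      obtain ⟨k, l, q, hq, rfl⟩ := hb
      refine pathClass_mul_of_ne (fun h => hyz ?_) p q
      subst h
      cases hp
      cases hq
      rfl

/-- A submodule of `A_F` which, together with an element, contains all path classes occurring in
that element is the sum of its homogeneous pieces. -/
theorem mem_iSup_idealPiece {N : Submodule F.Algᵐᵒᵖ F.Alg}
    (hN : ∀ y ∈ N, ∀ c, F.classBasis.repr y c ≠ 0 → classVal c ∈ N) (x : N) :
    x ∈ ⨆ φ, idealPiece N φ := by
  have hx : x = ∑ c ∈ (F.classBasis.repr x.1).support.attach, F.classBasis.repr x.1 c.1 •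
      (⟨classVal c.1, hN _ x.2 c.1 (Finsupp.mem_support_iff.1 c.2)⟩ : N) := by
    ext
    conv_lhs => rw [← F.classBasis.linearCombination_repr x.1, Finsupp.linearCombination_apply,
      Finsupp.sum, ← Finset.sum_attach]
    simp only [classBasis_apply, Submodule.coe_sum, Submodule.coe_smul_of_tower]
  rw [hx]
  refine Submodule.sum_mem _ fun c _ => Submodule.smul_mem _ _ ?_
  exact Submodule.mem_iSup_of_mem (classDegree c.1) (classVal_mem_piece c.1)

theorem isAlgebraGrading_piece (F : BraneTiling.{u}) : IsAlgebraGrading F.piece where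
  isInternal := by
    classical
    refine isInternal_of_components _ LinearMap.id (fun _ _ h => h) component
      (fun φ x hx => component_of_mem hx) (fun φ ψ h x hx => component_of_mem_of_ne h hx) ?_
    intro x
    rw [← F.classBasis.linearCombination_repr x, Finsupp.linearCombination_apply]
    refine Submodule.sum_mem _ fun c _ => Submodule.smul_mem _ _ ?_
    rw [classBasis_apply]
    exact Submodule.mem_iSup_of_mem _ (classVal_mem_piece c)
  mul_mem := piece_mul_mem
  mul_eq_zero := piece_mul_eq_zero

theorem isRightModuleGrading_idealPiece {N : Submodule F.Algᵐᵒᵖ F.Alg}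
    (hN : ∀ y ∈ N, ∀ c, F.classBasis.repr y c ≠ 0 → classVal c ∈ N) :
    IsRightModuleGrading F.piece (idealPiece N) where
  isInternal := by
    classical
    exact isInternal_of_components _ (N.subtype.restrictScalars ℂ) N.injective_subtype
      (fun φ => component φ ∘ₗ N.subtype.restrictScalars ℂ)
      (fun φ x hx => component_of_mem hx) (fun φ ψ h x hx => component_of_mem_of_ne h hx)
      (mem_iSup_idealPiece hN)
  smul_mem φ ψ _ _ hm ha := piece_mul_mem φ ψ hm ha
  smul_eq_zero φ ψ _ _ h hm ha := Subtype.ext (piece_mul_eq_zero φ ψ h hm ha)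

theorem isRightModuleGrading_sumPiece {ι : Type*} [Finite ι] {N : ι → Submodule F.Algᵐᵒᵖ F.Alg}
    (hN : ∀ k, ∀ y ∈ N k, ∀ c, F.classBasis.repr y c ≠ 0 → classVal c ∈ N k) :
    IsRightModuleGrading F.piece (sumPiece N) where
  isInternal := by
    classical
    cases nonempty_fintype ι
    refine isInternal_of_components _
      (LinearMap.pi fun k => (N k).subtype.restrictScalars ℂ ∘ₗ LinearMap.proj k :
        (∀ k, N k) →ₗ[ℂ] (ι → F.Alg))
      (fun x y h => funext fun k => Subtype.ext (congrFun h k))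
      (fun φ => LinearMap.pi fun k => component φ ∘ₗ (N k).subtype.restrictScalars ℂ ∘ₗ
        LinearMap.proj k)
      (fun φ x hx => funext fun k => component_of_mem (hx k trivial))
      (fun φ ψ h x hx => funext fun k => component_of_mem_of_ne h (hx k trivial)) ?_
    intro x
    rw [← Finset.univ_sum_single x]
    refine Submodule.sum_mem _ fun k _ => ?_
    have h : (⨆ φ, idealPiece (N k) φ).map (LinearMap.single ℂ (fun k => N k) k) ≤
        ⨆ φ, sumPiece N φ := by
      rw [Submodule.map_iSup]
      refine iSup_mono fun φ => Submodule.map_le_iff_le_comap.2 fun y hy l _ => ?_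
      rw [LinearMap.single_apply]
      by_cases hl : l = k
      · subst hl
        rwa [Pi.single_eq_same]
      · rw [Pi.single_eq_of_ne hl]
        exact Submodule.zero_mem _
    exact h ⟨x k, mem_iSup_idealPiece (hN k) (x k), rfl⟩
  smul_mem φ ψ _ _ hm ha := fun k _ => piece_mul_mem φ ψ (hm k trivial) ha
  smul_eq_zero φ ψ _ _ h hm ha :=
    funext fun k => Subtype.ext (piece_mul_eq_zero φ ψ h (hm k trivial) ha)

/-! ### The augmentation at a tile and the simple module -/

/-- The coefficient of the path of length zero at the tile `i`. -/
def augmentation (i : F.Tile) : F.Alg →ₗ[ℂ] ℂ :=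
  F.classBasis.coord (toClass (Quiver.Path.nil : Quiver.Path i i))

theorem augmentation_idem (i : F.Tile) : augmentation i (idem i) = 1 := by
  simp [augmentation, repr_pathClass]

theorem augmentation_eq_zero {i j k : F.Tile} (p : Quiver.Path j k)
    (h : pathClass p ≠ idem i) : augmentation i (pathClass p) = 0 := by
  classical
  rw [augmentation, Module.Basis.coord_apply, repr_pathClass, Finsupp.single_apply, if_neg]
  intro h'
  rw [← classVal_toClass, h'] at h
  exact h rfl

theorem augmentation_eq_zero_of_length {i j k : F.Tile} (p : Quiver.Path j k)
    (h : 1 ≤ p.length) : augmentation i (pathClass p) = 0 := by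
  refine augmentation_eq_zero p fun h' => ?_
  have := (length_eq_zero_iff_of_pathClass_eq h').2 rfl
  omega

theorem pathClass_eq_idem {i j : F.Tile} (p : Quiver.Path i j) (h : p.length = 0) :
    pathClass p = idem i := by
  cases p with
  | nil => rfl
  | cons p a => simp at h

theorem augmentation_mul (i : F.Tile) (x y : F.Alg) :
    augmentation i (x * y) = augmentation i x * augmentation i y := by
  induction x using alg_induction with
  | zero => simp
  | add x x' hx hx' => simp only [add_mul, map_add, hx, hx']
  | smul c x hx => simp only [smul_mul_assoc, map_smul, hx, smul_eq_mul, mul_assoc]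
  | path j k p =>
    induction y using alg_induction with
    | zero => simp
    | add x x' hx hx' => simp only [mul_add, map_add, hx, hx']
    | smul c x hx => simp only [mul_smul_comm, map_smul, hx, smul_eq_mul]; ring
    | path l m q =>
      rcases Nat.eq_zero_or_pos p.length with hp | hp
      · rw [pathClass_eq_idem p hp]
        by_cases hj : j = l
        · subst hj
          rw [pathClass_nil_mul]
          by_cases hi : i = j
          · subst hi
            rw [augmentation_idem, one_mul]
          · have hq : augmentation i (pathClass q) = 0 :=
              augmentation_eq_zero q fun h => hi (tail_eq_of_pathClass_eq h).symm
            rw [hq, mul_zero]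
        · rw [pathClass_mul_of_ne hj, map_zero]
          by_cases hi : i = j
          · rw [augmentation_eq_zero q, mul_zero]
            exact fun h => hj (hi ▸ (tail_eq_of_pathClass_eq h).symm)
          · rw [augmentation_eq_zero, zero_mul]
            exact fun h => hi (tail_eq_of_pathClass_eq h).symm
      · rw [augmentation_eq_zero_of_length p hp, zero_mul]
        by_cases h : k = l
        · subst h
          rw [← pathClass_comp, augmentation_eq_zero_of_length]
          rw [Quiver.Path.length_comp]; omega
        · rw [pathClass_mul_of_ne h, map_zero]

/-- The kernel of the augmentation at a tile, a right ideal. -/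
def augmentationIdeal (i : F.Tile) : Submodule F.Algᵐᵒᵖ F.Alg where
  carrier := {x | augmentation i x = 0}
  zero_mem' := map_zero _
  add_mem' {x y} hx hy := by
    change augmentation i _ = 0 at hx hy ⊢
    rw [map_add, hx, hy, add_zero]
  smul_mem' a x hx := by
    change augmentation i _ = 0 at hx ⊢
    exact (augmentation_mul i x a.unop).trans (by rw [hx, zero_mul])

theorem augmentation_of_mem_algPlus (i : F.Tile) {x : F.Alg} (hx : x ∈ F.algPlus) :
    augmentation i x = 0 := by
  induction hx using NonUnitalAlgebra.adjoin_induction with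
  | mem x h =>
    obtain ⟨j, k, p, h, rfl⟩ := h
    exact augmentation_eq_zero_of_length p h
  | zero => exact map_zero _
  | add x y _ _ hx hy => rw [map_add, hx, hy, add_zero]
  | mul x y _ _ hx hy => rw [augmentation_mul, hx, zero_mul]
  | smul c x _ hx => rw [map_smul, hx, smul_zero]

/-- The submodule `e_iA⁺` of `e_iA` is the kernel of the augmentation. -/
theorem mem_idemPlus {i : F.Tile} (y : Term₀ i) : y ∈ idemPlus i ↔ augmentation i y.1 = 0 := by
  refine ⟨fun h => ?_, fun h => ?_⟩
  · have h' : Submodule.span F.Algᵐᵒᵖ {x : F.Alg | ∃ y ∈ F.algPlus, x = idem i * y} ≤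
        augmentationIdeal i := by
      rw [Submodule.span_le]
      rintro _ ⟨x, hx, rfl⟩
      exact (augmentation_mul i _ _).trans (by rw [augmentation_of_mem_algPlus i hx, mul_zero])
    exact h' h
  · change y.1 ∈ Submodule.span F.Algᵐᵒᵖ {x : F.Alg | ∃ y ∈ F.algPlus, x = idem i * y}
    refine mem_of_forall_repr_ne_zero fun c hc => ?_
    obtain ⟨k, q, hq⟩ := exists_of_mem_support y.2 hc
    refine Submodule.subset_span ⟨pathClass q, NonUnitalAlgebra.subset_adjoin ℂ ⟨i, k, q, ?_, rfl⟩,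
      by rw [hq, pathClass_comp]⟩
    by_contra hlen
    rw [Quiver.Path.nil_comp, pathClass_eq_idem q (by omega)] at hq
    refine hc ?_
    have : c = toClass (Quiver.Path.nil : Quiver.Path i i) :=
      F.classBasis.injective (by rw [classBasis_apply, hq, classBasis_toClass])
    rw [this]
    exact h

/-- The generator `e_i` of `e_iA`. -/
def idemElt (i : F.Tile) : Term₀ i := ⟨idem i, Submodule.mem_span_singleton_self _⟩

theorem mkQ_eq_smul {i : F.Tile} (y : Term₀ i) :
    (idemPlus i).mkQ y = augmentation i y.1 • (idemPlus i).mkQ (idemElt i) := by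
  have h : y - augmentation i y.1 • idemElt i ∈ idemPlus i := by
    rw [mem_idemPlus]
    have : (y - augmentation i y.1 • idemElt i).1 = y.1 - augmentation i y.1 • idem i := rfl
    rw [this, map_sub, map_smul, augmentation_idem, smul_eq_mul, mul_one, sub_self]
  have h' : (idemPlus i).mkQ (y - augmentation i y.1 • idemElt i) = 0 := by
    rwa [← LinearMap.mem_ker, Submodule.ker_mkQ]
  rw [map_sub, sub_eq_zero] at h'
  exact h'

theorem isSimpleModule (i : F.Tile) : IsSimpleModule F.Algᵐᵒᵖ (SimpleModule i) := by
  rw [isSimpleModule_iff_toSpanSingleton_surjective]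
  have hker (y : Term₀ i) : (idemPlus i).mkQ y = 0 ↔ augmentation i y.1 = 0 := by
    rw [← LinearMap.mem_ker, Submodule.ker_mkQ, mem_idemPlus]
  refine ⟨⟨(idemPlus i).mkQ (idemElt i), 0, fun h => ?_⟩, fun m hm m' => ?_⟩
  · rw [hker] at h
    exact one_ne_zero ((augmentation_idem i).symm.trans h)
  · obtain ⟨y, rfl⟩ := (idemPlus i).mkQ_surjective m
    obtain ⟨y', rfl⟩ := (idemPlus i).mkQ_surjective m'
    have hy : augmentation i y.1 ≠ 0 := fun h => hm ((hker y).2 h)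
    refine ⟨MulOpposite.op ((augmentation i y'.1 / augmentation i y.1) • 1), ?_⟩
    rw [LinearMap.toSpanSingleton_apply, ← map_smul, mkQ_eq_smul y', mkQ_eq_smul (_ • y)]
    congr 1
    change augmentation i (y.1 * ((augmentation i y'.1 / augmentation i y.1) • 1)) = _
    rw [mul_smul_comm, mul_one, map_smul, smul_eq_mul, div_mul_cancel₀ _ hy]

theorem simplePiece_eq_zero {i : F.Tile} {φ : Mor F.G₁}
    (hφ : φ ≠ degree (Quiver.Path.nil : Quiver.Path i i)) {x : SimpleModule i}
    (hx : x ∈ simplePiece i φ) : x = 0 := by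
  obtain ⟨y, hy, rfl⟩ := hx
  have h : augmentation i y.1 = 0 := by
    have hy : y.1 ∈ F.piece φ := hy
    generalize y.1 = x at hy
    induction hy using Submodule.span_induction with
    | mem x h =>
      obtain ⟨j, k, p, rfl, rfl⟩ := h
      refine augmentation_eq_zero p fun h => hφ ?_
      have := congrArg classDegree (toClass_eq_of_pathClass_eq h)
      exact this
    | zero => exact map_zero _
    | add x y _ _ hx hy => rw [map_add, hx, hy, add_zero]
    | smul c x _ hx => rw [map_smul, hx, smul_zero]
  exact (mkQ_eq_smul y).trans (by rw [h, zero_smul])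

open Classical in
theorem isRightModuleGrading_simplePiece (i : F.Tile) :
    IsRightModuleGrading F.piece (simplePiece i) where
  isInternal := by
    refine isInternal_of_components _ LinearMap.id (fun _ _ h => h)
      (fun φ => if φ = degree (Quiver.Path.nil : Quiver.Path i i) then LinearMap.id else 0)
      (fun φ x hx => ?_) (fun φ ψ h x hx => ?_) fun x => ?_
    · split_ifs with hφ
      · rfl
      · exact (simplePiece_eq_zero hφ hx).symm
    · split_ifs with hφ
      · exact simplePiece_eq_zero (hφ ▸ h) hx
      · rfl
    · obtain ⟨y, rfl⟩ := (idemPlus i).mkQ_surjective x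
      rw [mkQ_eq_smul]
      refine Submodule.smul_mem _ _ (Submodule.mem_iSup_of_mem
        (degree (Quiver.Path.nil : Quiver.Path i i)) ⟨idemElt i, ?_, rfl⟩)
      exact pathClass_mem_piece _
  smul_mem φ ψ _ _ hm ha := by
    obtain ⟨y, hy, rfl⟩ := hm
    exact ⟨MulOpposite.op _ • y, piece_mul_mem φ ψ hy ha, rfl⟩
  smul_eq_zero φ ψ _ a h hm ha := by
    obtain ⟨y, hy, rfl⟩ := hm
    have : MulOpposite.op a • y = 0 := Subtype.ext (piece_mul_eq_zero φ ψ h hy ha)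
    refine ((idemPlus i).mkQ.map_smul (MulOpposite.op a) y).symm.trans ?_
    rw [this, map_zero]

/-! ### Projectivity -/

/-- Left multiplication, as a map of right modules. -/
def leftMul (x : F.Alg) : F.Alg →ₗ[F.Algᵐᵒᵖ] F.Alg where
  toFun y := x * y
  map_add' := mul_add x
  map_smul' a y := (mul_assoc x y a.unop).symm

theorem projective_alg : Module.Projective F.Algᵐᵒᵖ F.Alg :=
  Module.Projective.of_split (M := F.Algᵐᵒᵖ)
    ⟨⟨MulOpposite.op, fun _ _ => rfl⟩, fun _ _ => rfl⟩
    ⟨⟨MulOpposite.unop, fun _ _ => rfl⟩, fun _ _ => rfl⟩ rfl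

theorem idem_mul_of_mem {i : F.Tile} {y : F.Alg} (hy : y ∈ rightIdeal (idem i)) :
    idem i * y = y := by
  obtain ⟨z, rfl⟩ := mem_rightIdeal.1 hy
  rw [← mul_assoc, pathClass_mul_nil]

theorem projective_idem (i : F.Tile) : Module.Projective F.Algᵐᵒᵖ (rightIdeal (idem i)) := by
  have := projective_alg (F := F)
  refine Module.Projective.of_split (rightIdeal (idem i)).subtype
    ((leftMul (idem i)).codRestrict _ fun y => mem_rightIdeal.2 ⟨y, rfl⟩) ?_
  ext y
  exact idem_mul_of_mem y.2

theorem repr_pathClass_mul (hc : F.IsConsistent) {i j k : F.Tile} (p : Quiver.Path i j)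
    (q : Quiver.Path j k) (y : F.Alg) :
    F.classBasis.repr (pathClass p * y) (toClass (p.comp q)) =
      F.classBasis.repr y (toClass q) := by
  classical
  induction y using alg_induction with
  | zero => simp
  | add x y hx hy => simp only [mul_add, map_add, Finsupp.add_apply, hx, hy]
  | smul c x hx => simp only [mul_smul_comm, map_smul, Finsupp.smul_apply, hx]
  | path l m r =>
    by_cases h : j = l
    · subst h
      rw [← pathClass_comp, repr_pathClass, repr_pathClass, Finsupp.single_apply,
        Finsupp.single_apply]
      congr 1
      refine propext ⟨fun h => ?_, fun h => ?_⟩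
      · have h := congrArg classVal h
        simp only [classVal_toClass, pathClass_comp] at h
        exact toClass_eq_of_pathClass_eq (hc.pathClass_left_cancel p h)
      · have h := congrArg classVal h
        simp only [classVal_toClass] at h
        refine toClass_eq_of_pathClass_eq ?_
        rw [pathClass_comp, pathClass_comp, h]
    · rw [pathClass_mul_of_ne h, repr_pathClass, Finsupp.single_apply, if_neg]
      · simp
      · exact fun h' => h (congrArg Sigma.fst h').symm

/-- The right ideal generated by the class of a path ending at `j` is isomorphic to `e_jA`. -/
theorem projective_rightIdeal (hc : F.IsConsistent) {i j : F.Tile} (p : Quiver.Path i j) :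
    Module.Projective F.Algᵐᵒᵖ (rightIdeal (pathClass p)) := by
  have := projective_idem j
  let f : rightIdeal (idem j) →ₗ[F.Algᵐᵒᵖ] rightIdeal (pathClass p) :=
    ((leftMul (pathClass p)).comp (rightIdeal (idem j)).subtype).codRestrict _
      fun y => mem_rightIdeal.2 ⟨y, rfl⟩
  refine Module.Projective.of_equiv (LinearEquiv.ofBijective f ⟨?_, ?_⟩)
  · rw [← LinearMap.ker_eq_bot, LinearMap.ker_eq_bot']
    intro y hy
    have hy : pathClass p * y.1 = 0 := congrArg Subtype.val hy
    refine Subtype.ext (F.classBasis.repr.injective ?_)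
    ext c
    by_contra h
    rw [ZeroMemClass.coe_zero, map_zero, Finsupp.zero_apply] at h
    obtain ⟨k, q, hq⟩ := exists_of_mem_support y.2 h
    rw [Quiver.Path.nil_comp] at hq
    obtain rfl : c = toClass q :=
      F.classBasis.injective (by rw [classBasis_apply, hq, classBasis_toClass])
    rw [← repr_pathClass_mul hc p, hy] at h
    simp at h
  · intro y
    obtain ⟨z, hz⟩ := mem_rightIdeal.1 y.2
    refine ⟨⟨idem j * z, mem_rightIdeal.2 ⟨z, rfl⟩⟩, Subtype.ext ?_⟩
    change pathClass p * (idem j * z) = y.1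
    rw [← mul_assoc, pathClass_mul_nil, hz]

theorem projective_pi {R ι : Type*} [Ring R] [Finite ι] (M : ι → Type*)
    [∀ k, AddCommGroup (M k)] [∀ k, Module R (M k)] (h : ∀ k, Module.Projective R (M k)) :
    Module.Projective R (∀ k, M k) := by
  classical
  cases nonempty_fintype ι
  exact Module.Projective.of_equiv (DFinsupp.linearEquivFunOnFintype (R := R) (M := M))

/-! ### A cocycle from the genus -/

/-- The sum of the values of a function over the edges around the end of colour `c` of `e`. -/
def vertexSum (c : Colour) (f : F.Edge → ℚ) (e : F.Edge) : ℚ :=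
  ∑ k ∈ Finset.range (F.valence c e), f ((F.next c)^[k] e)

theorem vertexSum_next (c : Colour) (f : F.Edge → ℚ) (e : F.Edge) :
    vertexSum c f (F.next c e) = vertexSum c f e := by
  have h := Finset.sum_range_succ' (fun k => f ((F.next c)^[k] e)) (F.valence c e)
  rw [Finset.sum_range_succ, iterate_valence] at h
  simp only [Function.iterate_zero, id, add_left_inj] at h
  rw [vertexSum, vertexSum, valence_next, h]
  rfl

theorem vertexSum_congr (c : Colour) (f : F.Edge → ℚ) {a b : F.Edge}
    (h : (F.next c).SameCycle a b) : vertexSum c f a = vertexSum c f b := by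
  obtain ⟨n, rfl⟩ := h.exists_nat_pow_eq
  clear h
  induction n with
  | zero => rfl
  | succ n ih => rw [pow_succ', Equiv.Perm.mul_apply, vertexSum_next, ih]

theorem vertexSum_rep (c : Colour) (f : F.Edge → ℚ) (e : F.Edge) :
    vertexSum c f (F.vertex c e).rep = vertexSum c f e :=
  vertexSum_congr c f (Quotient.mk_out (s := Equiv.Perm.SameCycle.setoid (F.next c)) e)

/-- A cellular cocycle, on the cell structure of the surface dual to the tiling, which is not a
coboundary. -/
structure IsNontrivialCocycle (f : F.Edge → ℚ) : Prop where
  vertexSum_eq_zero : ∀ c e, vertexSum c f e = 0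
  not_coboundary : ∀ S : F.Tile → ℚ, ¬ ∀ e, f e = S (F.head e) - S (F.tail e)

/-- In positive genus there are at least as many edges as vertices and tiles together, so that the
space of cocycles has larger dimension than the space of coboundaries. -/
theorem exists_nontrivialCocycle (F : BraneTiling.{u}) {g : ℕ} (hg : 1 ≤ g) (hF : F.HasGenus g) :
    ∃ f : F.Edge → ℚ, IsNontrivialCocycle f := by
  cases nonempty_fintype F.Edge
  let Φ : (F.Edge → ℚ) →ₗ[ℚ] (F.Vertex .black → ℚ) × (F.Vertex .white → ℚ) :=
    { toFun f := (fun v => vertexSum .black f v.rep, fun v => vertexSum .white f v.rep)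
      map_add' f f' := by
        ext v <;> simp [vertexSum, Finset.sum_add_distrib]
      map_smul' r f := by
        ext v <;> simp [vertexSum, Finset.mul_sum] }
  let d : (F.Tile → ℚ) →ₗ[ℚ] (F.Edge → ℚ) :=
    { toFun S e := S (F.head e) - S (F.tail e)
      map_add' S S' := by
        ext e
        simp only [Pi.add_apply]
        ring
      map_smul' r S := by
        ext e
        simp only [Pi.smul_apply, smul_eq_mul, RingHom.id_apply]
        ring }
  have h : ¬ LinearMap.ker Φ ≤ LinearMap.range d := by
    intro hle
    have h1 := Submodule.finrank_mono hle
    have h2 := LinearMap.finrank_range_add_finrank_ker d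
    have h3 := LinearMap.finrank_range_add_finrank_ker Φ
    have h4 := (LinearMap.range Φ).finrank_le
    have h5 : 0 < Module.finrank ℚ (LinearMap.ker d) := by
      rw [Module.finrank_pos_iff]
      refine ⟨⟨fun _ => 1, ?_⟩, 0, fun h => ?_⟩
      · rw [LinearMap.mem_ker]
        ext e
        exact sub_self _
      · have := congrFun (congrArg Subtype.val h) (F.tail (Classical.arbitrary _))
        exact one_ne_zero this
    rw [Module.finrank_fintype_fun_eq_card] at h2 h3
    rw [Module.finrank_prod, Module.finrank_fintype_fun_eq_card,
      Module.finrank_fintype_fun_eq_card] at h4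
    simp only [HasGenus, Nat.card_eq_fintype_card] at hF
    omega
  obtain ⟨f, hf, hf'⟩ := SetLike.not_le_iff_exists.1 h
  rw [LinearMap.mem_ker] at hf
  refine ⟨f, fun c e => ?_, fun S hS => hf' ⟨S, (funext hS).symm⟩⟩
  cases c with
  | black => rw [← vertexSum_rep]; exact congrFun (congrArg Prod.fst hf) _
  | white => rw [← vertexSum_rep]; exact congrFun (congrArg Prod.snd hf) _

/-! ### Flows on infinite coverings -/

/-- A function on the edges which is constant around all vertices is constant, because the
surface is connected. -/
theorem eq_of_forall_next {α : Type*} (n : F.Edge → α) (h : ∀ c e, n (F.next c e) = n e)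
    (e e' : F.Edge) : n e = n e' := by
  obtain ⟨⟨g, hg⟩, rfl⟩ := F.connected.exists_smul_eq e e'
  have key : ∀ e, n (g e) = n e := by
    induction hg using Subgroup.closure_induction with
    | mem x hx =>
      rcases hx with rfl | rfl
      · exact h .black
      · exact h .white
    | one => exact fun e => rfl
    | mul x y _ _ hx hy => exact fun e => (hx (y e)).trans (hy e)
    | inv x _ hx => exact fun e => (hx (x⁻¹ e)).symm.trans (congrArg n (x.apply_symm_apply e))
  exact (key e).symm

/-- The finitely supported functions that are invariant under a permutation. -/
def invariants {X : Type*} (N : Equiv.Perm X) : Submodule ℚ (X →₀ ℚ) where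
  carrier := {z | ∀ x, z (N x) = z x}
  zero_mem' _ := rfl
  add_mem' hy hz x := by rw [Finsupp.add_apply, hy x, hz x, Finsupp.add_apply]
  smul_mem' r z hz x := by rw [Finsupp.smul_apply, hz x, Finsupp.smul_apply]

/-- Consider a covering of the tiling to which a cocycle, not a coboundary downstairs, lifts as the
coboundary of a height function. A function on its edges that is constant around all vertices
and finitely supported vanishes: averaging the height over the support would otherwise write the
cocycle as a coboundary downstairs. -/
theorem eq_zero_of_mem_invariants {X : Type*} {f : F.Edge → ℚ} (hf : IsNontrivialCocycle f)
    (N : Colour → Equiv.Perm X) (π : X → F.Edge) (height : X → ℚ)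
    (hπ : ∀ c x, π (N c x) = F.next c (π x))
    (hheight : ∀ c x, height (N c x) = height x + f (π x))
    {z : X →₀ ℚ} (hz : ∀ c, z ∈ invariants (N c)) : z = 0 := by
  classical
  by_contra hz0
  obtain ⟨x₀, hx₀⟩ := Finsupp.support_nonempty_iff.2 hz0
  let O (e : F.Edge) : Finset X := z.support.filter fun x => π x = e
  have hO (c : Colour) (e : F.Edge) : O (F.next c e) = (O e).map (N c).toEmbedding := by
    ext y
    obtain ⟨x, rfl⟩ := (N c).surjective y
    simp [O, hz c x, hπ]
  -- the number of lifts of `e` in the support does not depend on `e`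
  let n (e : F.Edge) : ℚ := (O e).card
  have hn (c e) : n (F.next c e) = n e := by simp only [n, hO, Finset.card_map]
  have hn0 (e) : n e ≠ 0 := by
    rw [eq_of_forall_next n hn e (π x₀), Nat.cast_ne_zero, Finset.card_ne_zero]
    exact ⟨x₀, Finset.mem_filter.2 ⟨hx₀, rfl⟩⟩
  let S (e : F.Edge) : ℚ := ∑ x ∈ O e, height x
  have hS (c e) : S (F.next c e) = S e + n e * f e := by
    simp only [S, hO, Finset.sum_map, Equiv.coe_toEmbedding, hheight, Finset.sum_add_distrib]
    rw [Finset.sum_congr rfl fun x hx => congrArg f (Finset.mem_filter.1 hx).2, Finset.sum_const,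
      nsmul_eq_mul]
  -- `S` only depends on the tile at which the arrow `e` starts
  have hS' (e) : S (F.tilePerm e) = S e := by
    obtain ⟨e, rfl⟩ := (F.next .black).surjective e
    have h : F.tilePerm (F.next .black e) = F.next .white e := by simp [tilePerm]
    rw [h, hS, hS]
  have hS'' (e e' : F.Edge) (h : F.tilePerm.SameCycle e e') : S e = S e' := by
    obtain ⟨k, rfl⟩ := h.exists_nat_pow_eq
    clear h
    induction k with
    | zero => rfl
    | succ k ih => rw [pow_succ', Equiv.Perm.mul_apply, hS', ih]
  let S' : F.Tile → ℚ := Quotient.lift S hS''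
  refine hf.not_coboundary (fun t => S' t / n (π x₀)) fun e => ?_
  change f e = S (F.next .black e) / n (π x₀) - S e / n (π x₀)
  rw [hS, eq_of_forall_next n hn (π x₀) e]
  field_simp [hn0 e]
  ring

/-- In the situation of `eq_zero_of_mem_invariants` there is a flow, given as a linear functional
on finitely supported chains of edges, whose only source is the black end of the edge `x₀`. It
exists because the functionals prescribing the divergence are linearly independent. -/
theorem exists_flow {X : Type*} {f : F.Edge → ℚ} (hf : IsNontrivialCocycle f)
    (N : Colour → Equiv.Perm X) (π : X → F.Edge) (height : X → ℚ)
    (hπ : ∀ c x, π (N c x) = F.next c (π x))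
    (hheight : ∀ c x, height (N c x) = height x + f (π x))
    (x₀ : X) (z₀ : X →₀ ℚ) (hz₀ : z₀ ∈ invariants (N .black)) (hz₀' : z₀ x₀ ≠ 0) :
    ∃ (θ : (X →₀ ℚ) →ₗ[ℚ] ℚ) (r : ℚ), r ≠ 0 ∧ (∀ z ∈ invariants (N .white), θ z = 0) ∧
      ∀ z ∈ invariants (N .black), θ z = r * z x₀ := by
  let K := (invariants (N .black) ⊓ LinearMap.ker (Finsupp.lapply x₀)) ⊔ invariants (N .white)
  have hK : z₀ ∉ K := by
    intro h
    obtain ⟨y, ⟨hy, hy'⟩, w, hw, rfl⟩ := Submodule.mem_sup.1 h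
    have hwB : w ∈ invariants (N .black) := by
      have := Submodule.sub_mem _ hz₀ hy
      rwa [add_sub_cancel_left] at this
    obtain rfl : w = 0 := eq_zero_of_mem_invariants hf N π height hπ hheight fun c => by
      cases c
      exacts [hwB, hw]
    rw [add_zero] at hz₀'
    exact hz₀' hy'
  obtain ⟨θ, hθ, hθK⟩ := Submodule.exists_le_ker_of_notMem hK
  refine ⟨θ, θ z₀ / z₀ x₀, div_ne_zero hθ hz₀', fun z hz => hθK (Submodule.mem_sup_right hz),
    fun z hz => ?_⟩
  have h : z - (z x₀ / z₀ x₀) • z₀ ∈ K := by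
    refine Submodule.mem_sup_left ⟨Submodule.sub_mem _ hz (Submodule.smul_mem _ _ hz₀), ?_⟩
    simp [hz₀']
  have h := hθK h
  rw [LinearMap.mem_ker, map_sub, map_smul, sub_eq_zero] at h
  rw [h, smul_eq_mul]
  ring

/-! ### The first arrow of a path -/

/-- The edge crossed by the first arrow of a path, if there is one. -/
def firstEdge {i : F.Tile} : ∀ {j : F.Tile}, Quiver.Path i j → Option F.Edge
  | _, .nil => none
  | _, .cons p a => (firstEdge p).or (some a.1)

theorem firstEdge_comp {i j k : F.Tile} (p : Quiver.Path i j) (q : Quiver.Path j k) :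
    firstEdge (p.comp q) = (firstEdge p).or (firstEdge q) := by
  induction q with
  | nil => simp [firstEdge]
  | cons q a ih => rw [Quiver.Path.comp_cons, firstEdge, ih, firstEdge, Option.or_assoc]

theorem firstEdge_cast {i j i' j' : F.Tile} (hi : i = i') (hj : j = j') (p : Quiver.Path i j) :
    firstEdge (p.cast hi hj) = firstEdge p := by
  subst hi hj; rfl

theorem firstEdge_walk_succ (c : Colour) (e : F.Edge) (k : ℕ) :
    firstEdge (F.walk c e (k + 1)) = some e := by
  induction k with
  | zero => rfl
  | succ k ih => rw [walk, firstEdge, ih]; rfl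

theorem firstEdge_brokenLoop (c : Colour) (a : F.Edge) :
    firstEdge (F.brokenLoop c a) = some (F.next c a) := by
  obtain ⟨n, hn⟩ := Nat.exists_eq_add_of_le (F.two_le_valence c a)
  rw [brokenLoop, firstEdge_cast, hn, show 2 + n - 1 = n + 1 by omega, firstEdge_walk_succ]

theorem firstEdge_eq_none {i j : F.Tile} {p : Quiver.Path i j} (h : firstEdge p = none) :
    p.length = 0 := by
  cases p with
  | nil => rfl
  | cons p a => simp [firstEdge] at h

/-- A path with a first arrow is the composition of this arrow with another path. -/
theorem exists_of_firstEdge_eq_some {i j : F.Tile} {p : Quiver.Path i j} {b : F.Edge}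
    (h : firstEdge p = some b) : ∃ (hb : F.tail b = i) (q : Quiver.Path (F.head b) j),
      p = (Quiver.Hom.toPath (⟨b, hb, rfl⟩ : i ⟶ F.head b)).comp q := by
  induction p with
  | nil => simp [firstEdge] at h
  | cons p a ih =>
    rw [firstEdge] at h
    cases hp : firstEdge p with
    | none =>
      rw [hp, Option.none_or, Option.some_inj] at h
      cases p with
      | nil =>
        obtain ⟨a, ha, rfl⟩ := a
        subst h
        exact ⟨ha, Quiver.Path.nil, rfl⟩
      | cons p a => simp [firstEdge] at hp
    | some b' =>
      rw [hp, Option.some_or, Option.some_inj] at h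
      subst h
      obtain ⟨hb, q, rfl⟩ := ih hp
      exact ⟨hb, q.cons a, rfl⟩

/-! ### The universal covering -/

/-- Two paths from the tile `i` to the starting tiles of two arrows are identified if the arrows are
the same and the paths differ, up to F-term equivalence, by simple loops; this means that the paths
are homotopic in the surface. -/
def coverSetoid (i : F.Tile) : Setoid (Σ e : F.Edge, Quiver.Path i (F.tail e)) where
  r x y := x.1 = y.1 ∧ ∃ m n : ℕ, pathClass x.2 * loopClass (F.tail x.1) ^ m =
    pathClass y.2 * loopClass (F.tail y.1) ^ n
  iseqv := by
    refine ⟨fun x => ⟨rfl, 0, 0, rfl⟩, ?_, ?_⟩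
    · rintro x y ⟨h, m, n, h'⟩
      exact ⟨h.symm, n, m, h'.symm⟩
    · rintro ⟨e, p⟩ ⟨e', p'⟩ ⟨e'', p''⟩ ⟨h, m, n, h'⟩ ⟨h₁, k, l, h₁'⟩
      dsimp only at h h₁ h' h₁' ⊢
      subst h h₁
      refine ⟨rfl, m + k, l + n, ?_⟩
      rw [pow_add, ← mul_assoc, h', mul_assoc, ← pow_add, add_comm n k, pow_add, ← mul_assoc, h₁',
        mul_assoc, ← pow_add]

/-- The edges of the tiling of the universal covering: an edge together with a homotopy class of
paths from the base tile `i` to the starting tile of its arrow. -/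
def CoverEdge (i : F.Tile) : Type u := _root_.Quotient (coverSetoid i)

namespace CoverEdge

variable {i : F.Tile}

/-- The lift of the edge `e` determined by a path. -/
def mk (e : F.Edge) (p : Quiver.Path i (F.tail e)) : CoverEdge i := Quotient.mk _ ⟨e, p⟩

theorem ind {P : CoverEdge i → Prop} (h : ∀ e p, P (mk e p)) (x : CoverEdge i) : P x := by
  induction x using Quotient.ind with
  | _ x => exact h x.1 x.2

theorem mk_eq_mk_iff {e : F.Edge} {p p' : Quiver.Path i (F.tail e)} :
    mk e p = mk e p' ↔ ∃ m n : ℕ, pathClass p * loopClass (F.tail e) ^ m =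
      pathClass p' * loopClass (F.tail e) ^ n :=
  ⟨fun h => (Quotient.exact h).2, fun h => Quotient.sound ⟨rfl, h⟩⟩

theorem mk_eq_of_pathClass_eq {e : F.Edge} {p p' : Quiver.Path i (F.tail e)}
    (h : pathClass p = pathClass p') : mk e p = mk e p' :=
  mk_eq_mk_iff.2 ⟨0, 0, by rw [h]⟩

theorem mk_congr {e e' : F.Edge} (h : e = e') (p : Quiver.Path i (F.tail e)) :
    mk e p = mk e' (p.cast rfl (congrArg F.tail h)) := by
  subst h; rfl

/-- The edge of which a given edge of the covering is a lift. -/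
def edge (x : CoverEdge i) : F.Edge := Quotient.lift (fun x => x.1) (fun _ _ h => And.left h) x

/-- The arrow `e`, ending at the starting tile of its successor around its end of colour `c`. -/
def stepArrow (c : Colour) (e : F.Edge) : F.tail e ⟶ F.tail (F.next c e) :=
  ⟨e, rfl, (tail_next c e).symm⟩

/-- The lift to the covering of the permutation `next c`, as a function. -/
def nextFun (c : Colour) (x : CoverEdge i) : CoverEdge i :=
  Quotient.lift (fun x => mk (F.next c x.1) (x.2.cons (stepArrow c x.1))) (by
    rintro ⟨e, p⟩ ⟨e', p'⟩ ⟨h, m, n, h'⟩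
    dsimp only at h h' ⊢
    subst h
    refine mk_eq_mk_iff.2 ⟨m, n, ?_⟩
    have h₁ : pathClass (stepArrow c e).toPath = arrowClass e := pathClass_toPath _
    rw [arrowClass_cons, arrowClass_cons]
    change _ * arrowClass e * _ = _ * arrowClass e * _
    rw [← h₁, mul_assoc, mul_assoc, ← loopClass_pow_mul_pathClass, ← loopClass_pow_mul_pathClass,
      ← mul_assoc, ← mul_assoc, h']) x

theorem nextFun_mk (c : Colour) (e : F.Edge) (p : Quiver.Path i (F.tail e)) :
    nextFun c (mk e p) = mk (F.next c e) (p.cons (stepArrow c e)) := rfl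

theorem iterate_nextFun_mk (c : Colour) (e : F.Edge) (p : Quiver.Path i (F.tail e)) (k : ℕ) :
    (nextFun c)^[k] (mk e p) = mk ((F.next c)^[k] e) (p.comp (F.walk c e k)) := by
  induction k with
  | zero => rfl
  | succ k ih =>
    rw [Function.iterate_succ_apply', ih, nextFun_mk,
      mk_congr (Function.iterate_succ_apply' _ _ _).symm]
    rw [walk, Quiver.Path.comp_cons, Quiver.Path.cast_cons]
    refine congrArg (fun a => mk _ (Quiver.Path.cons _ a)) (Subtype.ext ?_)
    rw [val_cast]; rfl

theorem pathClass_walk_valence (c : Colour) (e : F.Edge) :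
    pathClass (F.walk c e (F.valence c e)) = loopClass (F.tail e) := by
  rw [loopClass_tail c, pathClass, pathClass, ofPath_simpleLoop, ofPath_brokenLoop, ← walk_succ',
    Nat.sub_add_cancel (one_le_two.trans (F.two_le_valence c e))]

theorem iterate_nextFun_valence (c : Colour) (x : CoverEdge i) :
    (nextFun c)^[F.valence c x.edge] x = x := by
  induction x using ind with
  | h e p =>
    change (nextFun c)^[F.valence c e] (mk e p) = _
    rw [iterate_nextFun_mk, mk_congr (iterate_valence c e)]
    refine mk_eq_mk_iff.2 ⟨0, 1, ?_⟩
    rw [pathClass_cast, pathClass_comp, pathClass_walk_valence, pow_zero, pow_one, mul_one]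

variable (i) in
/-- The lift to the covering of the permutation `next c`. -/
def next (c : Colour) : Equiv.Perm (CoverEdge i) :=
  Equiv.ofBijective (nextFun c) <| by
    have h : Function.periodicPts (nextFun (i := i) c) = Set.univ :=
      Set.eq_univ_of_forall fun x => Function.mk_mem_periodicPts
        (lt_of_lt_of_le two_pos (F.two_le_valence c x.edge)) (iterate_nextFun_valence c x)
    rw [← Set.bijOn_univ, ← h]
    exact Function.bijOn_periodicPts _

theorem edge_next (c : Colour) (x : CoverEdge i) : (next i c x).edge = F.next c x.edge := by
  induction x using ind with
  | h e p => rfl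

theorem iterate_next_mk (c : Colour) (e : F.Edge) (p : Quiver.Path i (F.tail e)) (k : ℕ) :
    (next i c)^[k] (mk e p) = mk ((F.next c)^[k] e) (p.comp (F.walk c e k)) :=
  iterate_nextFun_mk c e p k

/-- The sum of the edges of the covering around the end of colour `c` of a given edge. -/
def orbit (c : Colour) (x : CoverEdge i) : CoverEdge i →₀ ℚ :=
  ∑ k ∈ Finset.range (F.valence c x.edge), Finsupp.single ((next i c)^[k] x) 1

theorem orbit_mem_invariants (c : Colour) (x : CoverEdge i) :
    orbit c x ∈ invariants (next i c) := by
  classical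
  intro y
  have h := Finset.sum_range_succ' (fun k => Finsupp.single ((next i c)^[k] x) (1 : ℚ))
    (F.valence c x.edge)
  rw [Finset.sum_range_succ, show (next i c)^[F.valence c x.edge] x = x from
    iterate_nextFun_valence c x] at h
  simp only [Function.iterate_zero, id, add_left_inj] at h
  conv_lhs => rw [orbit, h]
  rw [orbit, Finsupp.finsetSum_apply, Finsupp.finsetSum_apply]
  refine Finset.sum_congr rfl fun k _ => ?_
  rw [Function.iterate_succ_apply', Finsupp.single_apply, Finsupp.single_apply,
    (next i c).injective.eq_iff]

theorem orbit_apply_nonneg (c : Colour) (x y : CoverEdge i) : 0 ≤ orbit c x y := by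
  classical
  rw [orbit, Finsupp.finsetSum_apply]
  refine Finset.sum_nonneg fun k _ => ?_
  rw [Finsupp.single_apply]
  split_ifs <;> norm_num

theorem orbit_apply_self_pos (c : Colour) (x : CoverEdge i) : 0 < orbit c x x := by
  classical
  rw [orbit, Finsupp.finsetSum_apply]
  refine Finset.sum_pos' (fun k _ => ?_) ⟨0, Finset.mem_range.2 ?_, ?_⟩
  · rw [Finsupp.single_apply]
    split_ifs <;> norm_num
  · exact lt_of_lt_of_le two_pos (F.two_le_valence c x.edge)
  · simp

theorem orbit_apply_eq_zero {c : Colour} {x y : CoverEdge i}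
    (h : ∀ k < F.valence c x.edge, (next i c)^[k] x ≠ y) : orbit c x y = 0 := by
  classical
  rw [orbit, Finsupp.finsetSum_apply]
  refine Finset.sum_eq_zero fun k hk => ?_
  rw [Finsupp.single_apply, if_neg (h k (Finset.mem_range.1 hk))]

end CoverEdge

/-! ### The height function -/

/-- The sum of the values of a function on the edges along a path. -/
def weight (f : F.Edge → ℚ) {i : F.Tile} : ∀ {j : F.Tile}, Quiver.Path i j → ℚ
  | _, .nil => 0
  | _, .cons p a => weight f p + f a.1

theorem weight_comp (f : F.Edge → ℚ) {i j k : F.Tile} (p : Quiver.Path i j)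
    (q : Quiver.Path j k) : weight f (p.comp q) = weight f p + weight f q := by
  induction q with
  | nil => simp [weight]
  | cons q a ih => rw [Quiver.Path.comp_cons, weight, weight, ih, add_assoc]

theorem weight_cast (f : F.Edge → ℚ) {i j i' j' : F.Tile} (hi : i = i') (hj : j = j')
    (p : Quiver.Path i j) : weight f (p.cast hi hj) = weight f p := by
  subst hi hj; rfl

theorem weight_walk (f : F.Edge → ℚ) (c : Colour) (e : F.Edge) (k : ℕ) :
    weight f (F.walk c e k) = ∑ m ∈ Finset.range k, f ((F.next c)^[m] e) := by
  induction k with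
  | zero => rfl
  | succ k ih => rw [walk, weight, ih, Finset.sum_range_succ]

theorem IsNontrivialCocycle.weight_brokenLoop {f : F.Edge → ℚ} (hf : IsNontrivialCocycle f)
    (c : Colour) (a : F.Edge) : weight f (F.brokenLoop c a) = - f a := by
  have h := hf.vertexSum_eq_zero c (F.next c a)
  obtain ⟨n, hn⟩ := Nat.exists_eq_add_of_le (F.two_le_valence c a)
  have hn' := iterate_valence_sub_one c a
  rw [vertexSum, valence_next] at h
  rw [brokenLoop, weight_cast, weight_walk]
  rw [hn, show 2 + n - 1 = n + 1 by omega] at hn' ⊢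
  rw [hn, show 2 + n = n + 1 + 1 by omega, Finset.sum_range_succ, hn'] at h
  linarith

theorem IsNontrivialCocycle.weight_eq {f : F.Edge → ℚ} (hf : IsNontrivialCocycle f)
    {i j : F.Tile} {p q : Quiver.Path i j} (h : pathClass p = pathClass q) :
    weight f p = weight f q := by
  have h := pathClass_eq_iff.1 h
  clear * - h hf
  induction h with
  | rel p q h =>
    cases h with
    | mk a p q => simp only [weight_comp, hf.weight_brokenLoop]
  | refl => rfl
  | symm _ _ _ ih => exact ih.symm
  | trans _ _ _ _ _ ih ih' => exact ih.trans ih'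

theorem IsNontrivialCocycle.weight_loopPow {f : F.Edge → ℚ} (hf : IsNontrivialCocycle f)
    (i : F.Tile) (n : ℕ) : weight f (F.loopPow i n) = 0 := by
  induction n with
  | zero => rfl
  | succ n ih =>
    rw [loopPow, weight_comp, ih, weight_cast, simpleLoop, weight_comp, hf.weight_brokenLoop]
    simp [Quiver.Hom.toPath, weight, arrow]

/-- The function on the covering of which the lift of a cocycle is the coboundary. -/
def IsNontrivialCocycle.height {f : F.Edge → ℚ} (hf : IsNontrivialCocycle f) {i : F.Tile}
    (x : CoverEdge i) : ℚ :=
  Quotient.lift (fun x => weight f x.2) (by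
    rintro ⟨e, p⟩ ⟨e', p'⟩ ⟨h, m, n, h'⟩
    dsimp only at h h' ⊢
    subst h
    rw [← pathClass_comp_loopPow, ← pathClass_comp_loopPow] at h'
    have := hf.weight_eq h'
    rwa [weight_comp, weight_comp, hf.weight_loopPow, hf.weight_loopPow, add_zero,
      add_zero] at this) x

theorem IsNontrivialCocycle.height_next {f : F.Edge → ℚ} (hf : IsNontrivialCocycle f)
    {i : F.Tile} (c : Colour) (x : CoverEdge i) :
    hf.height (CoverEdge.next i c x) = hf.height x + f x.edge := by
  induction x using CoverEdge.ind with
  | h e p => rfl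

/-! ### The chain of a path -/

/-- The chain of edges of the covering crossed by the lift of a path. -/
def chain {i : F.Tile} : ∀ {j : F.Tile}, Quiver.Path i j → (CoverEdge i →₀ ℚ)
  | _, .nil => 0
  | _, .cons p a => chain p + Finsupp.single (CoverEdge.mk a.1 (p.cast rfl a.2.1.symm)) 1

theorem chain_cast {i j j' : F.Tile} (hj : j = j') (p : Quiver.Path i j) :
    chain (p.cast rfl hj) = chain p := by
  subst hj; rfl

theorem chain_walk {i : F.Tile} (c : Colour) (e : F.Edge) (p : Quiver.Path i (F.tail e)) (k : ℕ) :
    chain (p.comp (F.walk c e k)) =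
      chain p +
        ∑ m ∈ Finset.range k, Finsupp.single ((CoverEdge.next i c)^[m] (CoverEdge.mk e p)) 1 := by
  induction k with
  | zero => simp [walk]
  | succ k ih =>
    rw [walk, Quiver.Path.comp_cons, chain, ih, Finset.sum_range_succ,
      CoverEdge.iterate_next_mk, add_assoc]
    rfl

theorem comp_cast {i j j' k k' : F.Tile} (hj : j' = j) (hk : k = k') (p : Quiver.Path i j)
    (q : Quiver.Path j' k) :
    p.comp (q.cast hj hk) = ((p.cast rfl hj.symm).comp q).cast rfl hk := by
  subst hj hk; rfl

theorem chain_brokenLoop {i : F.Tile} (c : Colour) (a : F.Edge) (p : Quiver.Path i (F.head a)) :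
    chain (p.comp (F.brokenLoop c a)) +
        Finsupp.single (CoverEdge.mk a (p.comp (F.brokenLoop c a))) 1 =
      chain p +
        CoverEdge.orbit c (CoverEdge.mk (F.next c a) (p.cast rfl (tail_next c a).symm)) := by
  have hv := F.two_le_valence c a
  rw [brokenLoop, comp_cast, chain_cast, chain_walk, chain_cast, CoverEdge.orbit,
    ← CoverEdge.mk_congr (iterate_valence_sub_one c a), ← CoverEdge.iterate_next_mk, add_assoc,
    ← Finset.sum_range_succ]
  congr 3
  change _ = F.valence c (F.next c a)
  rw [valence_next]
  omega

theorem chain_comp_congr {i j k : F.Tile} {p q : Quiver.Path i j} (h : pathClass p = pathClass q)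
    (v : Quiver.Path j k) : chain (p.comp v) - chain (q.comp v) = chain p - chain q := by
  induction v with
  | nil => rfl
  | cons v a ih =>
    rw [Quiver.Path.comp_cons, Quiver.Path.comp_cons, chain, chain, ← ih,
      CoverEdge.mk_eq_of_pathClass_eq (p' := (q.comp v).cast rfl a.2.1.symm),
      add_sub_add_right_eq_sub]
    rw [pathClass_cast, pathClass_cast, pathClass_comp, pathClass_comp, h]

/-- An elementary move changes the chain of a path by the boundaries of the two faces
involved. -/
theorem chain_move {i j : F.Tile} (a : F.Edge) (p : Quiver.Path i (F.head a))
    (q : Quiver.Path (F.tail a) j) :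
    chain ((p.comp (F.brokenLoop .black a)).comp q) -
        chain ((p.comp (F.brokenLoop .white a)).comp q) =
      CoverEdge.orbit .black
          (CoverEdge.mk (F.next .black a) (p.cast rfl (tail_next .black a).symm)) -
        CoverEdge.orbit .white
          (CoverEdge.mk (F.next .white a) (p.cast rfl (tail_next .white a).symm)) := by
  have h : pathClass (p.comp (F.brokenLoop .black a)) =
      pathClass (p.comp (F.brokenLoop .white a)) := by
    rw [pathClass_comp, pathClass_comp, pathClass_brokenLoop .black .white]
  rw [chain_comp_congr h]
  have h₁ := chain_brokenLoop .black a p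
  have h₂ := chain_brokenLoop .white a p
  rw [CoverEdge.mk_eq_of_pathClass_eq h] at h₁
  rw [← eq_sub_iff_add_eq] at h₁ h₂
  rw [h₁, h₂]
  abel

/-! ### Divisibility by simple loops -/

/-- A closed path of positive length whose lift to the universal covering is closed begins, up to
F-term equivalence, with a simple loop. -/
theorem IsConsistent.mem_loopIdeal_of_closed (hc : F.IsConsistent) {i : F.Tile}
    (q : Quiver.Path i i) (hq : q.length ≠ 0) {m n : ℕ}
    (h : pathClass q * loopClass i ^ m = idem i * loopClass i ^ n) :
    pathClass q ∈ rightIdeal (loopClass i) := by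
  rcases Nat.lt_or_ge m n with hmn | hmn
  · obtain ⟨k, rfl⟩ := Nat.exists_eq_add_of_lt hmn
    have h' : pathClass q = pathClass (F.loopPow i (k + 1)) := hc _ _ ⟨m, by
      rw [h, pathClass_loopPow, mul_assoc, ← pow_add]
      congr 2
      omega⟩
    rw [h', pathClass_loopPow, pow_succ', ← mul_assoc, idem_mul_loopClass]
    exact mem_rightIdeal.2 ⟨_, rfl⟩
  -- otherwise `q` would become equivalent to a path of length zero after adding simple loops
  · obtain ⟨k, rfl⟩ := Nat.exists_eq_add_of_le hmn
    have h' : pathClass (q.comp (F.loopPow i k)) = idem i := hc _ _ ⟨n, by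
      rw [pathClass_comp_loopPow, mul_assoc, ← pow_add, add_comm k n, h]⟩
    have := (length_eq_zero_iff_of_pathClass_eq h').2 rfl
    rw [Quiver.Path.length_comp] at this
    omega

theorem walk_mem_rightIdeal (c : Colour) (e : F.Edge) {k n : ℕ} (h : k ≤ n) :
    pathClass (F.walk c e n) ∈ rightIdeal (pathClass (F.walk c e k)) := by
  induction n, h using Nat.le_induction with
  | base => exact Submodule.mem_span_singleton_self _
  | succ n _ ih =>
    rw [walk, arrowClass_cons]
    exact mul_mem_rightIdeal ih _

/-! ### Winding around a tile -/

section winding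

variable {b₀ : F.Edge} {θ : (CoverEdge (F.tail b₀) →₀ ℚ) →ₗ[ℚ] ℚ} {r : ℚ}

/-- The flow of a path is unchanged by an elementary move that is not at the start of
the path, unless the path begins, up to F-term equivalence, with a simple loop. Indeed the source
of the flow would have to lie on the black face of the move, so that the path returns to the
base tile. -/
theorem flow_chain_move (hc : F.IsConsistent)
    (hW : ∀ z ∈ invariants (CoverEdge.next (F.tail b₀) .white), θ z = 0)
    (hB : ∀ z ∈ invariants (CoverEdge.next (F.tail b₀) .black),
      θ z = r * z (CoverEdge.mk b₀ Quiver.Path.nil))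
    {j : F.Tile} (a : F.Edge) (p : Quiver.Path (F.tail b₀) (F.head a))
    (q : Quiver.Path (F.tail a) j) (hp : p.length ≠ 0)
    (hω : pathClass ((p.comp (F.brokenLoop .black a)).comp q) ∉
      rightIdeal (loopClass (F.tail b₀))) :
    θ (chain ((p.comp (F.brokenLoop .black a)).comp q)) =
      θ (chain ((p.comp (F.brokenLoop .white a)).comp q)) := by
  rw [← sub_eq_zero, ← map_sub, chain_move, map_sub, hW _ (CoverEdge.orbit_mem_invariants _ _),
    hB _ (CoverEdge.orbit_mem_invariants _ _), CoverEdge.orbit_apply_eq_zero, mul_zero, sub_zero]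
  intro k hk h
  replace hk : k < F.valence .black (F.next .black a) := hk
  rw [CoverEdge.iterate_next_mk] at h
  have hb : (F.next .black)^[k] (F.next .black a) = b₀ := congrArg CoverEdge.edge h
  rw [CoverEdge.mk_congr hb, CoverEdge.mk_eq_mk_iff] at h
  obtain ⟨m, n, h⟩ := h
  have hmem := hc.mem_loopIdeal_of_closed _ (by
    rw [length_cast, Quiver.Path.length_comp, length_cast]; omega) h
  rw [pathClass_cast, pathClass_comp, pathClass_cast] at hmem
  refine hω ?_
  rw [valence_next] at hk
  obtain ⟨z, hz⟩ := mem_rightIdeal.1 (walk_mem_rightIdeal .black (F.next .black a)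
    (show k ≤ F.valence .black a - 1 by omega))
  rw [pathClass_comp, pathClass_comp, brokenLoop, pathClass_cast, hz, ← mul_assoc, mul_assoc _ z]
  exact mul_mem_rightIdeal hmem _

theorem flow_chain_congr (hc : F.IsConsistent)
    (hW : ∀ z ∈ invariants (CoverEdge.next (F.tail b₀) .white), θ z = 0)
    (hB : ∀ z ∈ invariants (CoverEdge.next (F.tail b₀) .black),
      θ z = r * z (CoverEdge.mk b₀ Quiver.Path.nil))
    {j k : F.Tile} (s : Quiver.Path (F.tail b₀) k) (hs : s.length ≠ 0)
    {q q' : Quiver.Path k j} (h : Relation.EqvGen FMove q q')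
    (hω : pathClass s * pathClass q ∉ rightIdeal (loopClass (F.tail b₀))) :
    θ (chain (s.comp q)) = θ (chain (s.comp q')) := by
  induction h with
  | rel q q' h =>
    cases h with
    | mk a p q =>
      simp only [← Quiver.Path.comp_assoc]
      refine flow_chain_move hc hW hB a (s.comp p) q ?_ ?_
      · rw [Quiver.Path.length_comp]; omega
      · rwa [← pathClass_comp, ← Quiver.Path.comp_assoc, ← Quiver.Path.comp_assoc] at hω
  | refl => rfl
  | symm _ _ h ih => exact (ih (by rwa [pathClass_eq_iff.2 h])).symm
  | trans _ _ _ h _ ih ih' => exact (ih hω).trans (ih' (by rwa [← pathClass_eq_iff.2 h]))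

/-- The flow of a path only depends on the class and the first arrow of the path. -/
theorem flow_chain_eq (hc : F.IsConsistent)
    (hW : ∀ z ∈ invariants (CoverEdge.next (F.tail b₀) .white), θ z = 0)
    (hB : ∀ z ∈ invariants (CoverEdge.next (F.tail b₀) .black),
      θ z = r * z (CoverEdge.mk b₀ Quiver.Path.nil))
    {j : F.Tile} {p q : Quiver.Path (F.tail b₀) j} (hpq : pathClass p = pathClass q) {b : F.Edge}
    (hp : firstEdge p = some b) (hq : firstEdge q = some b)
    (hω : pathClass p ∉ rightIdeal (loopClass (F.tail b₀))) :
    θ (chain p) = θ (chain q) := by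
  obtain ⟨hb, p, rfl⟩ := exists_of_firstEdge_eq_some hp
  obtain ⟨_, q, rfl⟩ := exists_of_firstEdge_eq_some hq
  rw [pathClass_comp, pathClass_comp] at hpq
  rw [pathClass_comp] at hω
  exact flow_chain_congr hc hW hB _ (by simp)
    (pathClass_eq_iff.1 (hc.pathClass_left_cancel _ hpq)) hω

end winding

theorem firstArrow_bijective (i : F.Tile) (c : Colour) :
    Function.Bijective (firstArrow (i := i) c) := by
  refine ⟨fun a a' h => Subtype.ext ((F.next c).injective (congrArg Subtype.val h)), fun b => ?_⟩
  obtain ⟨a, ha⟩ := (F.next c).surjective b.1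
  exact ⟨⟨a, by rw [← tail_next c, ha, b.2]⟩, Subtype.ext ha⟩

theorem pathClass_nil_cast_comp {i j k : F.Tile} (h : i = j) (q : Quiver.Path j k) :
    pathClass (((Quiver.Path.nil : Quiver.Path i i).cast rfl h).comp q) = pathClass q := by
  subst h
  exact congrArg _ (Quiver.Path.nil_comp q)

theorem coverMk_nil_cast {b₀ a : F.Edge} (c : Colour) (hb : F.next c a = b₀)
    (h : F.tail b₀ = F.head a) :
    CoverEdge.mk (F.next c a) (((Quiver.Path.nil : Quiver.Path (F.tail b₀) (F.tail b₀)).cast rfl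
      h).cast rfl (tail_next c a).symm) = CoverEdge.mk b₀ Quiver.Path.nil := by
  subst hb
  rw [Quiver.Path.cast_cast]; rfl

/-- A path that begins, up to F-term equivalence, with the broken loop of each of the arrows going
into its first tile also begins with a simple loop.

If it did not, then no path in its class would return to the base tile in the universal
covering. Rotating the first arrow once around the base tile changes the flow of the path by
the strength of the source, but brings back the same path. -/
theorem mem_loopIdeal_of_forall_mem (hc : F.IsConsistent) {f : F.Edge → ℚ}
    (hf : IsNontrivialCocycle f) {i j : F.Tile} (p : Quiver.Path i j)
    (hp : ∀ a : Incoming i, pathClass p ∈ rightIdeal (brokenClass a.1)) :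
    pathClass p ∈ rightIdeal (loopClass i) := by
  classical
  by_contra hω
  obtain ⟨b₀, rfl⟩ : ∃ b, F.tail b = i := ⟨i.rep, tail_rep i⟩
  obtain ⟨θ, r, hr, hW, hB⟩ := exists_flow hf (CoverEdge.next (F.tail b₀)) CoverEdge.edge hf.height
    CoverEdge.edge_next hf.height_next (CoverEdge.mk b₀ Quiver.Path.nil)
    (CoverEdge.orbit .black (CoverEdge.mk b₀ Quiver.Path.nil))
    (CoverEdge.orbit_mem_invariants _ _) (CoverEdge.orbit_apply_self_pos _ _).ne'
  let start (a : Incoming (F.tail b₀)) : Quiver.Path (F.tail b₀) (F.head a.1) :=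
    Quiver.Path.nil.cast rfl a.2.symm
  choose v hv using fun a => exists_of_pathClass_mem (hp a)
  let path (c : Colour) (a : Incoming (F.tail b₀)) : Quiver.Path (F.tail b₀) j :=
    ((start a).comp (F.brokenLoop c a.1)).comp (v a)
  have hpath (c a) : pathClass (path c a) = pathClass p := by
    simp only [path, start]
    rw [pathClass_comp, pathClass_nil_cast_comp, hv, pathClass_comp,
      pathClass_brokenLoop c .black]
  have hfirst (c a) : firstEdge (path c a) = some (firstArrow c a).1 := by
    simp only [path, start, firstEdge_comp, firstEdge_cast, firstEdge_brokenLoop]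
    rfl
  -- the flow of the paths that are equivalent to `p` and begin with the arrow `b`
  let w (b : Outgoing (F.tail b₀)) : ℚ :=
    if h : ∃ q : Quiver.Path (F.tail b₀) j, pathClass p = pathClass q ∧ firstEdge q = some b.1 then
      θ (chain h.choose) else 0
  have hw (c a) : w (firstArrow c a) = θ (chain (path c a)) := by
    have h : ∃ q : Quiver.Path (F.tail b₀) j,
        pathClass p = pathClass q ∧ firstEdge q = some (firstArrow c a).1 :=
      ⟨path c a, (hpath c a).symm, hfirst c a⟩
    simp only [w, dif_pos h]
    exact flow_chain_eq hc hW hB (h.choose_spec.1.symm.trans (hpath c a).symm) h.choose_spec.2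
      (hfirst c a) (by rwa [← h.choose_spec.1])
  -- how often the source occurs on the black face of `a`
  let N (a : Incoming (F.tail b₀)) : ℚ := CoverEdge.orbit .black
    (CoverEdge.mk (F.next .black a.1) ((start a).cast rfl (tail_next .black a.1).symm))
    (CoverEdge.mk b₀ Quiver.Path.nil)
  have hN (a) : w (firstArrow .black a) - w (firstArrow .white a) = r * N a := by
    rw [hw, hw, ← map_sub]
    simp only [path]
    rw [chain_move, map_sub, hW _ (CoverEdge.orbit_mem_invariants _ _),
      hB _ (CoverEdge.orbit_mem_invariants _ _), sub_zero]
  -- both ends of `a` give bijections from the incoming to the outgoing arrows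
  have hsum : ∑ a : Incoming (F.tail b₀), r * N a = 0 := by
    rw [← Finset.sum_congr rfl fun a _ => hN a, Finset.sum_sub_distrib,
      (firstArrow_bijective _ .black).sum_comp w, (firstArrow_bijective _ .white).sum_comp w,
      sub_self]
  rw [← Finset.mul_sum, mul_eq_zero, or_iff_right hr] at hsum
  obtain ⟨a₀, ha₀⟩ := (firstArrow_bijective (F.tail b₀) .black).2 ⟨b₀, rfl⟩
  have hb₀ : F.next .black a₀.1 = b₀ := congrArg Subtype.val ha₀
  refine (Finset.sum_pos' (fun a _ => CoverEdge.orbit_apply_nonneg _ _ _)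
    ⟨a₀, Finset.mem_univ _, ?_⟩).ne' hsum
  simp only [start]
  rw [coverMk_nil_cast .black hb₀]
  exact CoverEdge.orbit_apply_self_pos _ _

/-! ### Exactness -/

section exactness

variable {i : F.Tile}

theorem tau_apply (x : Term₃ i) (a : Incoming i) : (tau i x a).1 = x.1 := by
  rw [tau, LinearMap.pi_apply, Submodule.coe_inclusion]

theorem rho_apply (x : Term₁ i) : (rho i x).1 = ∑ b, (x b).1 := by
  simp only [rho, LinearMap.sum_apply, Submodule.coe_sum, LinearMap.comp_apply,
    LinearMap.proj_apply, Submodule.coe_inclusion]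

open Classical in
theorem iota_apply (c : Colour) (a : Incoming i) (x : rightIdeal (brokenClass a.1))
    (b : Outgoing i) : (iota c a x b).1 = if firstArrow c a = b then x.1 else 0 := by
  simp only [iota, LinearMap.comp_apply, LinearMap.single_apply]
  by_cases h : firstArrow c a = b
  · subst h
    rw [Pi.single_eq_same, if_pos rfl]
    exact Submodule.coe_inclusion (brokenIdeal_le c a.1) x
  · rw [Pi.single_eq_of_ne (Ne.symm h), if_neg h, ZeroMemClass.coe_zero]

open Classical in
theorem sigma_apply (x : Term₂ i) (b : Outgoing i) : (sigma i x b).1 =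
    ∑ a, ((if firstArrow .black a = b then (x a).1 else 0) -
      if firstArrow .white a = b then (x a).1 else 0) := by
  simp only [sigma, LinearMap.sum_apply, Finset.sum_apply, Submodule.coe_sum]
  refine Finset.sum_congr rfl fun a _ => ?_
  rw [← iota_apply, ← iota_apply]
  rfl

theorem exact_rho (i : F.Tile) : Function.Exact (rho i) (idemPlus i).mkQ := by
  rw [LinearMap.exact_iff, Submodule.ker_mkQ]
  ext y
  rw [mem_idemPlus]
  constructor
  · intro hy
    classical
    -- each path class occurring in `y` has positive length, hence a first arrow
    have key : y.1 ∈ (LinearMap.range (rho i)).map (rightIdeal (idem i)).subtype := by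
      refine mem_of_forall_repr_ne_zero fun c hc => ?_
      obtain ⟨k, q, hq⟩ := exists_of_mem_support y.2 hc
      rw [Quiver.Path.nil_comp] at hq
      cases hb : firstEdge q with
      | none =>
        rw [pathClass_eq_idem q (firstEdge_eq_none hb)] at hq
        have : c = toClass (Quiver.Path.nil : Quiver.Path i i) :=
          F.classBasis.injective (by rw [classBasis_apply, hq, classBasis_toClass])
        rw [this] at hc
        exact absurd hy hc
      | some b =>
        obtain ⟨hb', q, rfl⟩ := exists_of_firstEdge_eq_some hb
        clear hb
        have hmem : pathClass (Quiver.Hom.toPath (⟨b, hb', rfl⟩ : i ⟶ F.head b)) * pathClass q ∈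
            rightIdeal (arrowClass b) := by
          rw [pathClass_toPath]
          exact mem_rightIdeal.2 ⟨_, rfl⟩
        refine ⟨rho i (Pi.single ⟨b, hb'⟩ ⟨_, hmem⟩), ⟨_, rfl⟩, ?_⟩
        rw [Submodule.subtype_apply, rho_apply, Finset.sum_eq_single ⟨b, hb'⟩,
          Pi.single_eq_same, hq, pathClass_comp]
        · intro b' _ h
          rw [Pi.single_eq_of_ne h]; rfl
        · simp
    obtain ⟨z, hz, hzy⟩ := key
    rwa [← Subtype.ext hzy]
  · rintro ⟨x, rfl⟩
    rw [rho_apply, map_sum]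
    refine Finset.sum_eq_zero fun b _ => ?_
    obtain ⟨z, hz⟩ := mem_rightIdeal.1 (x b).2
    rw [hz, augmentation_mul, augmentation_eq_zero_of_length _ le_rfl, zero_mul]

variable (i) in
/-- The inclusion of `⨁_{b ∈ E₂} [b]A` into `⨁_{b ∈ E₂} A`. -/
def forget : Term₁ i →ₗ[ℂ] (Outgoing i → F.Alg) :=
  LinearMap.pi fun b => (rightIdeal (arrowClass b.1)).subtype.restrictScalars ℂ ∘ₗ LinearMap.proj b

theorem forget_injective : Function.Injective (forget i) :=
  fun _ _ h => funext fun b => Subtype.ext (congrFun h b)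

variable (i) in
/-- The image of `σ` in `⨁_{b ∈ E₂} A`. -/
def sigmaRange : Submodule ℂ (Outgoing i → F.Alg) :=
  ((LinearMap.range (sigma i)).restrictScalars ℂ).map (forget i)

open Classical in
variable (i) in
/-- The class of a path, placed in the summand of its first arrow. -/
def placed {j k : F.Tile} (p : Quiver.Path j k) : Outgoing i → F.Alg :=
  fun b => if firstEdge p = some b.1 then pathClass p else 0

/-- Modulo the image of `σ`, an elementary move at the start of a path moves its class from one
summand to another one. -/
theorem placed_sub_placed_mem {j k : F.Tile} {p q : Quiver.Path j k} (h : FMove p q) :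
    placed i p - placed i q ∈ sigmaRange i := by
  classical
  have hpq := pathClass_move h
  cases h with
  | mk a p q =>
    cases hp : firstEdge p with
    | some b =>
      convert Submodule.zero_mem (sigmaRange i)
      rw [sub_eq_zero]
      funext b
      simp only [placed, hpq, firstEdge_comp, hp, Option.some_or]
    | none =>
      have hB : firstEdge ((p.comp (F.brokenLoop .black a)).comp q) = some (F.next .black a) := by
        simp only [firstEdge_comp, hp, firstEdge_brokenLoop]; rfl
      have hW : firstEdge ((p.comp (F.brokenLoop .white a)).comp q) = some (F.next .white a) := by
        simp only [firstEdge_comp, hp, firstEdge_brokenLoop]; rfl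
      by_cases ha : F.head a = i
      · have hmem : pathClass ((p.comp (F.brokenLoop .black a)).comp q) ∈
            rightIdeal (brokenClass a) := by
          obtain rfl := Quiver.Path.eq_of_length_zero p (firstEdge_eq_none hp)
          rw [pathClass_comp, pathClass_comp, pathClass_eq_idem p (firstEdge_eq_none hp),
            pathClass_nil_mul]
          exact mem_rightIdeal.2 ⟨_, rfl⟩
        refine ⟨sigma i (Pi.single ⟨a, ha⟩ ⟨_, hmem⟩), ⟨_, rfl⟩, ?_⟩
        funext b
        change (sigma i _ b).1 = _
        rw [sigma_apply, Finset.sum_eq_single ⟨a, ha⟩, Pi.single_eq_same, Pi.sub_apply, placed,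
          placed, hB, hW, ← hpq]
        · simp only [firstArrow, Subtype.ext_iff, Option.some_inj]
        · intro a' _ h
          rw [Pi.single_eq_of_ne h]
          simp
        · simp
      · convert Submodule.zero_mem (sigmaRange i)
        funext b
        have hb (c : Colour) : F.next c a ≠ b.1 := fun h => ha (by rw [← tail_next c, h, b.2])
        simp only [Pi.sub_apply, placed, hB, hW, Option.some_inj, hb, if_false, sub_zero,
          Pi.zero_apply]

variable (i) in
/-- Sending a path class to the class of the path in the summand of its first arrow is well-defined
modulo the image of `σ`. -/
def unsum : F.Alg →ₗ[ℂ] (Outgoing i → F.Alg) ⧸ sigmaRange i :=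
  F.classBasis.constr ℂ fun c => Quot.lift (fun p => (sigmaRange i).mkQ (placed i p))
    (fun _ _ h => by
      rw [← sub_eq_zero, ← map_sub, ← LinearMap.mem_ker, Submodule.ker_mkQ]
      exact placed_sub_placed_mem h) c.2.2

theorem unsum_pathClass {j k : F.Tile} (p : Quiver.Path j k) :
    unsum i (pathClass p) = (sigmaRange i).mkQ (placed i p) := by
  rw [← classBasis_toClass, unsum, Module.Basis.constr_basis]
  rfl

open Classical in
theorem unsum_arrowClass_mul (b : Outgoing i) (z : F.Alg) :
    unsum i (arrowClass b.1 * z) = (sigmaRange i).mkQ (Pi.single b (arrowClass b.1 * z)) := by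
  induction z using alg_induction with
  | zero => simp
  | add x y hx hy => rw [mul_add, map_add, hx, hy, ← map_add, ← Pi.single_add]
  | smul c x hx => rw [mul_smul_comm, map_smul, hx, ← map_smul, ← Pi.single_smul]
  | path j k q =>
    by_cases h : F.head b.1 = j
    · subst h
      rw [← pathClass_comp, unsum_pathClass]
      congr 1
      funext b'
      have hb : firstEdge ((F.arrow b.1).toPath.comp q) = some b.1 := by
        rw [firstEdge_comp]; rfl
      rw [placed, hb]
      by_cases h : b' = b
      · subst h
        rw [Pi.single_eq_same, if_pos rfl]
      · rw [Pi.single_eq_of_ne h, if_neg]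
        exact fun h' => h (Subtype.ext (Option.some_inj.1 h').symm)
    · rw [pathClass_mul_of_ne h, map_zero, Pi.single_zero, map_zero]

theorem exact_sigma (i : F.Tile) : Function.Exact (sigma i) (rho i) := by
  classical
  rw [LinearMap.exact_iff]
  ext x
  rw [LinearMap.mem_ker]
  constructor
  · intro hx
    have hx : ∑ b, (x b).1 = 0 := by rw [← rho_apply, hx]; rfl
    have key : (sigmaRange i).mkQ (forget i x) = 0 := by
      rw [← Finset.univ_sum_single (forget i x), map_sum, ← map_zero (unsum i), ← hx, map_sum]
      refine Finset.sum_congr rfl fun b _ => ?_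
      obtain ⟨z, hz⟩ := mem_rightIdeal.1 (x b).2
      change (sigmaRange i).mkQ (Pi.single b (x b).1) = _
      rw [hz, unsum_arrowClass_mul]
    rw [← LinearMap.mem_ker, Submodule.ker_mkQ] at key
    obtain ⟨y, hy, hyx⟩ := key
    rwa [← forget_injective hyx]
  · rintro ⟨x, rfl⟩
    refine Subtype.ext ?_
    rw [rho_apply]
    simp only [sigma_apply]
    rw [Finset.sum_comm]
    simp

theorem sum_firstArrow (c : Colour) (b : Outgoing i) (y : Incoming i → F.Alg) {a : Incoming i}
    (ha : firstArrow c a = b) [DecidableEq (Outgoing i)] :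
    ∑ a, (if firstArrow c a = b then y a else 0) = y a := by
  rw [Finset.sum_eq_single a, if_pos ha]
  · intro a' _ h
    rw [if_neg]
    exact fun h' => h ((firstArrow_bijective i c).1 (h'.trans ha.symm))
  · simp

/-- On the kernel of `σ` all components agree, since the edges of a tile form a single cycle. -/
theorem eq_of_sigma_eq_zero {x : Term₂ i} (hx : sigma i x = 0) (a a' : Incoming i) :
    (x a).1 = (x a').1 := by
  classical
  have step (a a' : Incoming i) (h : firstArrow .white a = firstArrow .black a') :
      (x a).1 = (x a').1 := by
    have h₁ := sigma_apply x (firstArrow .black a')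
    rw [Finset.sum_sub_distrib, sum_firstArrow .black _ (fun a => (x a).1) rfl,
      sum_firstArrow .white _ (fun a => (x a).1) h, hx] at h₁
    exact (sub_eq_zero.1 h₁.symm).symm
  have hcycle : F.tilePerm.SameCycle (F.next .black a.1) (F.next .black a'.1) :=
    Quotient.exact (((tail_next .black a.1).trans a.2).trans
      ((tail_next .black a'.1).trans a'.2).symm)
  obtain ⟨n, hn⟩ := hcycle.exists_nat_pow_eq
  induction n generalizing a with
  | zero =>
    rw [Subtype.ext ((F.next .black).injective hn)]
  | succ n ih =>
    obtain ⟨a'', ha''⟩ := (firstArrow_bijective i .black).2 (firstArrow .white a)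
    rw [step a a'' ha''.symm]
    have h : F.tilePerm (F.next .black a.1) = F.next .black a''.1 := by
      rw [show F.next .black a''.1 = F.next .white a.1 from congrArg Subtype.val ha'']
      simp [tilePerm]
    rw [pow_succ, Equiv.Perm.mul_apply, h] at hn
    exact ih a'' ⟨n, by exact_mod_cast hn⟩ hn

theorem exists_incoming (i : F.Tile) : Nonempty (Incoming i) :=
  ⟨((firstArrow_bijective i .black).2 ⟨i.rep, tail_rep i⟩).choose⟩

theorem tau_injective (i : F.Tile) : Function.Injective (tau i) := by
  obtain ⟨a⟩ := exists_incoming i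
  intro x y h
  exact Subtype.ext (by rw [← tau_apply x a, h, tau_apply])

theorem exact_tau (hc : F.IsConsistent) {f : F.Edge → ℚ} (hf : IsNontrivialCocycle f)
    (i : F.Tile) : Function.Exact (tau i) (sigma i) := by
  classical
  rw [LinearMap.exact_iff]
  ext x
  rw [LinearMap.mem_ker]
  constructor
  · intro hx
    obtain ⟨a₀⟩ := exists_incoming i
    have hall (a : Incoming i) : (x a₀).1 ∈ rightIdeal (brokenClass a.1) := by
      rw [eq_of_sigma_eq_zero hx a₀ a]
      exact (x a).2
    have hmem : (x a₀).1 ∈ rightIdeal (loopClass i) := by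
      refine mem_of_forall_repr_ne_zero fun c hc' => ?_
      have hall' (a : Incoming i) := classVal_mem_of_repr_ne_zero (hall a) hc'
      obtain ⟨k, q, hq⟩ := exists_of_mem_support (x a₀).2 hc'
      rw [hq, ← pathClass_cast a₀.2 rfl] at hall' ⊢
      exact mem_loopIdeal_of_forall_mem hc hf _ hall'
    exact ⟨⟨_, hmem⟩, funext fun a => Subtype.ext (by
      rw [tau_apply, eq_of_sigma_eq_zero hx a₀ a])⟩
  · rintro ⟨x, rfl⟩
    funext b
    refine Subtype.ext ?_
    obtain ⟨a, ha⟩ := (firstArrow_bijective i .black).2 b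
    obtain ⟨a', ha'⟩ := (firstArrow_bijective i .white).2 b
    rw [sigma_apply, Finset.sum_sub_distrib, sum_firstArrow .black _ (fun a => (tau i x a).1) ha,
      sum_firstArrow .white _ (fun a => (tau i x a).1) ha', tau_apply, tau_apply, sub_self]
    rfl

end exactness

end BraneTiling

end

theorem theorem3p1 (F : BraneTiling) (g : ℕ) (hg : 1 ≤ g) (hF : F.HasGenus g)
    (hc : F.IsConsistent) :
    IsAlgebraGrading F.piece ∧
      ∀ i : F.Tile, IsSimpleModule F.Algᵐᵒᵖ (BraneTiling.SimpleModule i) ∧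
        IsGradedProjectiveResolution F.piece
          (BraneTiling.idealPiece (BraneTiling.rightIdeal (BraneTiling.loopClass i)))
          (BraneTiling.sumPiece fun a : BraneTiling.Incoming i =>
            BraneTiling.rightIdeal (BraneTiling.brokenClass a.1))
          (BraneTiling.sumPiece fun b : BraneTiling.Outgoing i =>
            BraneTiling.rightIdeal (BraneTiling.arrowClass b.1))
          (BraneTiling.idealPiece (BraneTiling.rightIdeal (BraneTiling.idem i)))
          (BraneTiling.simplePiece i)
          (BraneTiling.tau i) (BraneTiling.sigma i) (BraneTiling.rho i)
          (BraneTiling.idemPlus i).mkQ := by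
  obtain ⟨f, hf⟩ := BraneTiling.exists_nontrivialCocycle F hg hF
  refine ⟨BraneTiling.isAlgebraGrading_piece F, fun i => ⟨BraneTiling.isSimpleModule i, ?_⟩⟩
  exact
    { grading₃ := BraneTiling.isRightModuleGrading_idealPiece fun _ hy _ h =>
        BraneTiling.classVal_mem_of_repr_ne_zero hy h
      grading₂ := BraneTiling.isRightModuleGrading_sumPiece fun _ _ hy _ h =>
        BraneTiling.classVal_mem_of_repr_ne_zero hy h
      grading₁ := BraneTiling.isRightModuleGrading_sumPiece fun _ _ hy _ h =>
        BraneTiling.classVal_mem_of_repr_ne_zero hy h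
      grading₀ := BraneTiling.isRightModuleGrading_idealPiece fun _ hy _ h =>
        BraneTiling.classVal_mem_of_repr_ne_zero hy h
      grading := BraneTiling.isRightModuleGrading_simplePiece i
      map_mem₃ := fun φ x hx a _ => by
        change (BraneTiling.tau i x a).1 ∈ F.piece φ
        rw [BraneTiling.tau_apply]
        exact hx
      map_mem₂ := fun φ x hx b _ => by
        classical
        change (BraneTiling.sigma i x b).1 ∈ F.piece φ
        rw [BraneTiling.sigma_apply]
        refine Submodule.sum_mem _ fun a _ => Submodule.sub_mem _ ?_ ?_
        all_goals
          split_ifs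
          · exact hx a trivial
          · exact Submodule.zero_mem _
      map_mem₁ := fun φ x hx => by
        change (BraneTiling.rho i x).1 ∈ F.piece φ
        rw [BraneTiling.rho_apply]
        exact Submodule.sum_mem _ fun b _ => hx b trivial
      map_mem := fun φ x hx => ⟨x, hx, rfl⟩
      projective₃ := BraneTiling.projective_rightIdeal hc _
      projective₂ := BraneTiling.projective_pi _ fun a => BraneTiling.projective_rightIdeal hc _
      projective₁ := BraneTiling.projective_pi _ fun b => BraneTiling.projective_rightIdeal hc _
      projective₀ := BraneTiling.projective_rightIdeal hc _
      injective := BraneTiling.tau_injective i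
      exact₂ := BraneTiling.exact_tau hc hf i
      exact₁ := BraneTiling.exact_sigma i
      exact₀ := BraneTiling.exact_rho i
      surjective := (BraneTiling.idemPlus i).mkQ_surjective }
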